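/- Let $G=(V,E)$ be a finite simple graph with no isolated edge, i.e. every edge of $G$ shares a vertex with some other edge of $G$ (isolated vertices are allowed). Then $G$ is total weight $(1,5)$-choosable. That is, for every list assignment $L$ which assigns to each vertex $v\in V$ a set $L(v)$ of $1$ real number and to each edge $e\in E$ a set $L(e)$ of $5$ real numbers, there is a map $\phi: V\cup E\to\mathbb{R}$ with $\phi(z)\in L(z)$ for all $z\in V\cup E$ such that $$\sum_{e\in E(u)}\phi(e)+\phi(u)\neq\sum_{e\in E(v)}\phi(e)+\phi(v)$$ for every edge $\{u,v\}\in E$, where $E(v)$ denotes the set of edges incident to $v$. -/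

import Mathlib

namespace SimpleGraph

section TotalWeighting

variable {V : Type*} (G : SimpleGraph V)

/-- An isolated edge of `G`: an edge that shares no vertex with any other edge. -/
def IsIsolatedEdge (e : Sym2 V) : Prop :=
  e ∈ G.edgeSet ∧ ∀ f ∈ G.edgeSet, ∀ v : V, v ∈ e → v ∈ f → f = e

/-- A graph is nice if it has no isolated edge (isolated vertices are allowed). -/
def IsNice : Prop :=
  ∀ e : Sym2 V, ¬ G.IsIsolatedEdge e

/-- The index set `V ∪ E` of a total weighting is the disjoint union `V ⊕ G.edgeSet`.
The weighted sum at `v` is the weight of `v` plus the weights of the edges incident to `v`. -/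
def weightedSum [Fintype V] [DecidableEq V] [DecidableRel G.Adj]
    (φ : V ⊕ G.edgeSet → ℝ) (v : V) : ℝ :=
  (∑ e ∈ Finset.univ.filter (fun e : G.edgeSet => v ∈ e.1), φ (Sum.inr e)) + φ (Sum.inl v)

/-- A total weighting is proper if adjacent vertices have distinct weighted sums. -/
def IsProperTotalWeighting [Fintype V] [DecidableEq V] [DecidableRel G.Adj]
    (φ : V ⊕ G.edgeSet → ℝ) : Prop :=
  ∀ u v : V, G.Adj u v → G.weightedSum φ u ≠ G.weightedSum φ v

/-- `G` is total weight `ψ`-choosable: every assignment of a set `L z` of `ψ z` real numbers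
to each vertex and edge `z` admits a proper total weighting with `φ z ∈ L z` for all `z`. -/
def TotalWeightChoosable [Fintype V] [DecidableEq V] [DecidableRel G.Adj]
    (ψ : V ⊕ G.edgeSet → ℕ) : Prop :=
  ∀ L : V ⊕ G.edgeSet → Finset ℝ, (∀ z, (L z).card = ψ z) →
    ∃ φ : V ⊕ G.edgeSet → ℝ, (∀ z, φ z ∈ L z) ∧ G.IsProperTotalWeighting φ

/-- `G` is total weight `(k, k')`-choosable: lists of size `k` at the vertices and of size `k'`
at the edges. -/
def TotalWeightPairChoosable [Fintype V] [DecidableEq V] [DecidableRel G.Adj]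
    (k k' : ℕ) : Prop :=
  G.TotalWeightChoosable (Sum.elim (fun _ => k) (fun _ => k'))

end TotalWeighting

end SimpleGraph

/-! Orient the edges and let Q be the product over them of the differences of the two incident-edge
sums. The fixed vertex weights only add constants to the factors, so by the Combinatorial
Nullstellensatz it suffices that Q has a monomial with all exponents at most 4. This holds if Q does
not vanish under some substitution of elements with zero fifth power
(`totalWeightPairChoosable_of_nilpotent`).

Substitute for the variable of e the sum of `z j e * X j` over j, where every `X j` squares to zero.
If at most four of the edge vectors `z j` are nonzero at e, the fifth power vanishes. The factor of
an edge uv becomes a form with coefficients "boundary of `z j` at v minus boundary at u", so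
nonvanishing of Q reduces to a nonzero permanent. With an independent set A and vectors of two
kinds, the matrix is block triangular. Vectors for edges outside A have a boundary with a leading
vertex, which gives a triangular pattern. Vectors for edges meeting A have boundary inside A, either
a single vertex or `a ± a'`. The latter are taken twice, so that their forms multiply to a square H²
with H a product of forms `x ± y`; its middle coefficient is, up to sign, a sum of squares
(`coeff_mul_self_ne_zero`). `totalWeightPairChoosable_of_forms` packages this as a combinatorial
certificate.

For the certificate, A is a maximum independent set of least degree sum
(`IsNice.exists_independent`). A vertex outside A with several neighbours in A uses differences of
its edges into A. A vertex b whose only A-neighbour is a, shared with another such vertex, can use a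
triangle through a. The remaining vertices, each the only private neighbour of its a, are joined in
pairs by short edge-disjoint paths outside A (`exists_pairing`). What is left is to choose these
vectors so that no edge is used more than four times. -/

/-- A sum of `n` square-zero elements of a commutative ring has vanishing `(n + 1)`-st power. -/
theorem sum_pow_card_succ_eq_zero {S ι : Type*} [CommRing S] (s : Finset ι) (x : ι → S)
    (h : ∀ i ∈ s, x i ^ 2 = 0) : (∑ i ∈ s, x i) ^ (s.card + 1) = 0 := by
  classical
  induction s using Finset.induction_on with
  | empty => simp
  | insert a s ha ih =>
    rw [Finset.sum_insert ha, Finset.card_insert_of_notMem ha]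
    refine (Commute.all _ _).add_pow_eq_zero_of_add_le_succ_of_pow_eq_zero
      (h a (Finset.mem_insert_self a s)) (ih fun i hi => h i (Finset.mem_insert_of_mem hi)) ?_
    omega

/-! ### Coefficients of products of linear forms. -/

namespace MvPolynomial

/-- Equal exponent vectors mean fibres of equal size, and bijections between fibres glue to a
permutation. -/
theorem exists_perm_comp_eq {J V : Type*} [Fintype J] (f a : J → V)
    (h : ∑ j, Finsupp.single (f j) 1 = ∑ j, Finsupp.single (a j) (1 : ℕ)) :
    ∃ σ : Equiv.Perm J, f = a ∘ σ := by
  classical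
  have key : ∀ v, Fintype.card {j // f j = v} = Fintype.card {j // a j = v} := by
    intro v
    have := DFunLike.congr_fun h v
    simpa [Finsupp.finsetSum_apply, Finsupp.single_apply, Finset.sum_boole, Fintype.card_subtype]
      using this
  refine ⟨Equiv.ofFiberEquiv fun v => Fintype.equivOfCardEq (key v), ?_⟩
  funext j
  exact (Equiv.ofFiberEquiv_map _ j).symm

theorem coeff_prod_linear {J V R : Type*} [Fintype J] [DecidableEq J] [Fintype V] [DecidableEq V]
    [CommSemiring R] (g : J → V → R) (N : V →₀ ℕ) :
    coeff N (∏ j, ∑ v, C (g j v) * X v) =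
      ∑ f : J → V, if ∑ j, Finsupp.single (f j) 1 = N then ∏ j, g j (f j) else 0 := by
  rw [Finset.prod_univ_sum, coeff_sum, Fintype.piFinset_univ]
  refine Finset.sum_congr rfl fun f _ => ?_
  have : ∏ j, (C (g j (f j)) * X (f j) : MvPolynomial V R) =
      monomial (∑ j, Finsupp.single (f j) 1) (∏ j, g j (f j)) := by
    rw [Finset.prod_mul_distrib, ← map_prod, monomial_eq]
    congr 1
    rw [Finsupp.prod_fintype _ _ (by simp)]
    simp only [Finsupp.finsetSum_apply]
    rw [Finset.prod_congr rfl fun v _ => (Finset.prod_pow_eq_pow_sum _ _ _).symm, Finset.prod_comm]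
    refine Finset.prod_congr rfl fun j _ => ?_
    rw [Finset.prod_eq_single (f j)] <;> simp +contextual
  rw [this, coeff_monomial]

/-- The sum over permutations counts every arrangement of a multiset equally often. -/
theorem card_stabilizer_mul_coeff_prod_linear {J V R : Type*} [Fintype J] [DecidableEq J]
    [Fintype V] [DecidableEq V] [CommSemiring R] (g : J → V → R) (a : J → V) :
    ((Finset.univ.filter fun σ : Equiv.Perm J => a ∘ σ = a).card : R) *
      coeff (∑ j, Finsupp.single (a j) 1) (∏ j, ∑ v, C (g j v) * X v) =
      ∑ σ : Equiv.Perm J, ∏ j, g j (a (σ j)) := by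
  rw [coeff_prod_linear, Finset.mul_sum]
  have h1 : ∑ σ : Equiv.Perm J, ∏ j, g j (a (σ j)) =
      ∑ f : J → V, ∑ σ ∈ Finset.univ.filter (fun σ : Equiv.Perm J => a ∘ σ = f),
        ∏ j, g j (a (σ j)) :=
    (Finset.sum_fiberwise_of_maps_to (fun _ _ => Finset.mem_univ _) _).symm
  rw [h1]
  refine Finset.sum_congr rfl fun f _ => ?_
  have h2 : ∑ σ ∈ Finset.univ.filter (fun σ : Equiv.Perm J => a ∘ σ = f), ∏ j, g j (a (σ j)) =
      ((Finset.univ.filter fun σ : Equiv.Perm J => a ∘ σ = f).card : R) * ∏ j, g j (f j) := by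
    rw [← nsmul_eq_mul, ← Finset.sum_const]
    refine Finset.sum_congr rfl fun σ hσ => ?_
    rw [← (Finset.mem_filter.1 hσ).2]; rfl
  rw [h2]
  split_ifs with h
  · obtain ⟨τ, rfl⟩ := exists_perm_comp_eq f a h
    congr 2
    refine Finset.card_bij (fun σ _ => σ * τ) ?_ ?_ ?_
    · intro σ hσ
      simp only [Finset.mem_filter, Finset.mem_univ, true_and] at hσ ⊢
      rw [Equiv.Perm.coe_mul, ← Function.comp_assoc, hσ]
    · intro σ _ σ' _ hh; exact mul_right_cancel hh
    · intro σ hσ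
      refine ⟨σ * τ⁻¹, ?_, by simp⟩
      simp only [Finset.mem_filter, Finset.mem_univ, true_and] at hσ ⊢
      rw [Equiv.Perm.coe_mul, ← Function.comp_assoc, hσ, Function.comp_assoc, ← Equiv.Perm.coe_mul]
      simp
  · rw [mul_zero, Finset.card_eq_zero.2, Nat.cast_zero, zero_mul]
    refine Finset.filter_eq_empty_iff.2 fun σ _ hσ => h ?_
    rw [← hσ]
    exact Equiv.sum_comp σ fun j => Finsupp.single (a j) (1 : ℕ)

theorem coeff_prod_linear_eq_permanent {J R : Type*} [Fintype J] [DecidableEq J] [CommSemiring R]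
    (m : Matrix J J R) :
    coeff (∑ j, Finsupp.single j 1) (∏ i, ∑ j, C (m i j) * X j) = m.permanent := by
  have h := card_stabilizer_mul_coeff_prod_linear (fun i j => m i j) (id : J → J)
  have h1 : (Finset.univ.filter fun σ : Equiv.Perm J => id ∘ σ = id) = {1} := by
    ext σ
    simp only [Finset.mem_filter, Finset.mem_univ, true_and, Finset.mem_singleton,
      Function.id_comp]
    exact ⟨fun h => Equiv.ext fun x => congrFun h x, fun h => by rw [h]; rfl⟩
  rw [h1, Finset.card_singleton, Nat.cast_one, one_mul] at h
  simp only [id] at h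
  rw [h, ← Matrix.permanent_transpose]
  rfl

/-- Elements of the ideal generated by the squares of the variables have no squarefree part. -/
theorem coeff_sum_single_eq_zero_of_mem {J R : Type*} [Fintype J] [CommRing R]
    {p : MvPolynomial J R} (hp : p ∈ Ideal.span (Set.range fun j : J => (X j : MvPolynomial J R) ^ 2)) :
    coeff (∑ j, Finsupp.single j 1) p = 0 := by
  classical
  obtain ⟨c, rfl⟩ := Submodule.mem_span_range_iff_exists_fun _ |>.1 hp
  rw [coeff_sum]
  refine Finset.sum_eq_zero fun j _ => ?_
  rw [smul_eq_mul, X_pow_eq_monomial, coeff_mul_monomial', if_neg]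
  intro h
  have := h j
  simp [Finsupp.finsetSum_apply, Finsupp.single_apply] at this

/-- The middle coefficient of the square of a product of forms `x ± y` is, up to sign, the sum of
the squares of the coefficients of the product. -/
theorem coeff_mul_self_ne_zero {M V : Type*} [Fintype M] [DecidableEq M] [Fintype V]
    [DecidableEq V] (α β : M → V) (hαβ : ∀ μ, α μ ≠ β μ) (s : M → ℝ)
    (hs : ∀ μ, s μ = 1 ∨ s μ = -1) :
    coeff (∑ μ, (Finsupp.single (α μ) 1 + Finsupp.single (β μ) 1))
      ((∏ μ, (X (α μ) + C (s μ) * X (β μ))) * ∏ μ, (X (α μ) + C (s μ) * X (β μ)) :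
        MvPolynomial V ℝ) ≠ 0 := by
  set H : MvPolynomial V ℝ := ∏ μ, (X (α μ) + C (s μ) * X (β μ)) with hH
  set N : V →₀ ℕ := ∑ μ, (Finsupp.single (α μ) 1 + Finsupp.single (β μ) 1) with hN
  -- `T` records the factors from which the first variable is chosen; complementary choices have
  -- exponents adding up to `N`.
  let cnt : Finset M → V →₀ ℕ := fun T =>
    ∑ μ ∈ T, Finsupp.single (α μ) 1 + ∑ μ ∈ Tᶜ, Finsupp.single (β μ) 1
  have hcnt : ∀ T, cnt T + cnt Tᶜ = N := by
    intro T
    simp only [cnt, compl_compl, hN, Finset.sum_add_distrib]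
    rw [← Finset.sum_add_sum_compl T fun μ => Finsupp.single (α μ) (1 : ℕ),
      ← Finset.sum_add_sum_compl T fun μ => Finsupp.single (β μ) (1 : ℕ)]
    abel
  have hexp : H = ∑ T : Finset M, monomial (cnt T) (∏ μ ∈ Tᶜ, s μ) := by
    rw [hH, Finset.prod_add, Finset.powerset_univ]
    refine Finset.sum_congr rfl fun T _ => ?_
    rw [← Finset.compl_eq_univ_sdiff, Finset.prod_mul_distrib, ← map_prod]
    have hmon : ∀ (γ : M → V) (U : Finset M),
        ∏ μ ∈ U, (X (γ μ) : MvPolynomial V ℝ) = monomial (∑ μ ∈ U, Finsupp.single (γ μ) 1) 1 := by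
      intro γ U
      simp only [X, ← monomial_sum_one]
    rw [hmon, hmon, mul_left_comm, monomial_mul, one_mul, C_mul_monomial, mul_one]
  have hcoeff : ∀ p, coeff p H = ∑ T : Finset M, if cnt T = p then ∏ μ ∈ Tᶜ, s μ else 0 := by
    intro p
    rw [hexp, coeff_sum]
    simp only [coeff_monomial]
  have hs2 : ∀ μ, s μ * s μ = 1 := fun μ => by rcases hs μ with h | h <;> rw [h] <;> norm_num
  -- Complementing `T` reflects the exponent in `N` and, since the signs square to 1, multiplies the
  -- term by the product of all signs. Hence the convolution for the coefficient at `N` pairs each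
  -- coefficient with itself.
  have hrev : ∀ p q, p + q = N → coeff q H = (∏ μ, s μ) * coeff p H := by
    intro p q hpq
    rw [hcoeff, hcoeff, Finset.mul_sum, ← (Equiv.sum_comp (Function.Involutive.toPerm
      (compl : Finset M → Finset M) compl_involutive) fun T => if cnt T = q then ∏ μ ∈ Tᶜ, s μ else 0)]
    refine Finset.sum_congr rfl fun T _ => ?_
    simp only [Function.Involutive.coe_toPerm, compl_compl]
    have : cnt Tᶜ = q ↔ cnt T = p := by
      have h := hcnt T
      constructor
      · intro hq
        rw [hq, ← hpq] at h
        exact add_right_cancel h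
      · intro hp
        rw [hp, ← hpq] at h
        exact add_left_cancel h
    simp only [this]
    split_ifs
    · rw [← Finset.prod_mul_prod_compl T s, mul_assoc, ← Finset.prod_mul_distrib,
        Finset.prod_congr rfl fun μ _ => hs2 μ, Finset.prod_const_one, mul_one]
    · rw [mul_zero]
  have hH0 : H ≠ 0 := by
    refine Finset.prod_ne_zero_iff.2 fun μ _ h => ?_
    have := congrArg (coeff (Finsupp.single (α μ) 1)) h
    simp [coeff_X, coeff_C_mul, Finsupp.single_left_inj, (hαβ μ).symm] at this
  have hsq : coeff N (H * H) =
      (∏ μ, s μ) * ∑ x ∈ Finset.HasAntidiagonal.antidiagonal N, coeff x.1 H ^ 2 := by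
    rw [coeff_mul, Finset.mul_sum]
    refine Finset.sum_congr rfl fun x hx => ?_
    rw [hrev x.1 x.2 (Finset.HasAntidiagonal.mem_antidiagonal.1 hx)]
    ring
  rw [hsq]
  refine mul_ne_zero (Finset.prod_ne_zero_iff.2 fun μ _ => ?_) ?_
  · rcases hs μ with h | h <;> rw [h] <;> norm_num
  · obtain ⟨p, hp⟩ := ne_zero_iff.1 hH0
    have : ∃ T, cnt T = p := by
      by_contra! hcon
      exact hp (by rw [hcoeff]; exact Finset.sum_eq_zero fun T _ => if_neg (hcon T))
    obtain ⟨T, rfl⟩ := this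
    refine (Finset.sum_pos' (fun x _ => sq_nonneg _)
      ⟨(cnt T, cnt Tᶜ), Finset.HasAntidiagonal.mem_antidiagonal.2 (hcnt T), ?_⟩).ne'
    exact sq_pos_of_ne_zero hp
end MvPolynomial

/-! ### Permanents. -/

namespace Matrix

/-- As for determinants: a permutation that does not preserve the two index sets meets the zero
block, and the others split as pairs. -/
theorem permanent_fromBlocks_zero₁₂ {m n R : Type*} [Fintype m] [DecidableEq m] [Fintype n]
    [DecidableEq n] [CommSemiring R] (A : Matrix m m R) (C : Matrix n m R) (D : Matrix n n R) :
    (Matrix.fromBlocks A 0 C D).permanent = A.permanent * D.permanent := by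
  rw [← permanent_transpose, fromBlocks_transpose, ← A.permanent_transpose,
    ← D.permanent_transpose, transpose_zero]
  generalize Aᵀ = A, Dᵀ = D, Cᵀ = B
  classical
  unfold permanent
  convert!
    Eq.symm <|
      Finset.sum_subset (M := R)
        (Finset.subset_univ ((Equiv.Perm.sumCongrHom m n).range : Set (Equiv.Perm (m ⊕ n))).toFinset) ?_
  · simp_rw [Finset.sum_mul_sum, ← Finset.sum_product', Finset.univ_product_univ]
    refine Finset.sum_nbij (fun σ ↦ σ.fst.sumCongr σ.snd) ?_ ?_ ?_ ?_
    · intro σ₁₂ _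
      rw [Set.mem_toFinset]
      exact ⟨σ₁₂, rfl⟩
    · intro σ₁ _ σ₂ _
      dsimp only
      intro h
      have h2 : ∀ x, Equiv.Perm.sumCongr σ₁.fst σ₁.snd x = Equiv.Perm.sumCongr σ₂.fst σ₂.snd x :=
        DFunLike.congr_fun h
      simp only [Sum.map_inr, Sum.map_inl, Equiv.Perm.sumCongr_apply, Sum.forall, Sum.inl.injEq,
        Sum.inr.injEq] at h2
      ext x
      · exact h2.left x
      · exact h2.right x
    · intro σ hσ
      rw [Finset.mem_coe, Set.mem_toFinset] at hσ
      obtain ⟨σ₁₂, hσ₁₂⟩ := hσ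
      use σ₁₂
      rw [← hσ₁₂]
      simp
    · simp only [forall_prop_of_true, Prod.forall, Finset.mem_univ]
      intro σ₁ σ₂
      rw [Fintype.prod_sum_type]
      simp_rw [Equiv.sumCongr_apply, Sum.map_inr, Sum.map_inl, fromBlocks_apply₁₁,
        fromBlocks_apply₂₂]
  · rintro σ - hσn
    have h1 : ¬∀ x, ∃ y, Sum.inl y = σ (Sum.inl x) := by
      rw [Set.mem_toFinset] at hσn
      simpa only [Set.MapsTo, Set.mem_range, forall_exists_index, forall_apply_eq_imp_iff] using
        mt Equiv.Perm.mem_sumCongrHom_range_of_perm_mapsTo_inl hσn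
    obtain ⟨a, ha⟩ := not_forall.mp h1
    rcases hx : σ (Sum.inl a) with a2 | b
    · have hn := (not_exists.mp ha) a2
      exact absurd hx.symm hn
    · rw [Finset.prod_eq_zero (Finset.mem_univ (Sum.inl a))]
      rw [hx, fromBlocks_apply₂₁, zero_apply]

/-- A matrix with zero entries whenever the rank of the row is smaller than that of the column, and
ones on equal ranks, has nonzero permanent. -/
theorem permanent_ne_zero_of_rank {n : Type*} [Fintype n] [DecidableEq n] (m : Matrix n n ℝ)
    (r : n → ℕ) (h0 : ∀ i j, r i < r j → m i j = 0) (h1 : ∀ i j, r i = r j → m i j = 1) :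
    m.permanent ≠ 0 := by
  refine (Finset.sum_pos' (fun σ _ => ?_) ⟨1, Finset.mem_univ _, ?_⟩).ne'
  · by_cases h : ∃ i, r (σ i) < r i
    · obtain ⟨i, hi⟩ := h
      rw [Finset.prod_eq_zero (f := fun i => m (σ i) i) (Finset.mem_univ i) (h0 _ _ hi)]
    · push Not at h
      -- A permutation preserves the total rank, so one that never lowers a rank preserves every
      -- rank, and all its entries are 1.
      have heq : ∀ i ∈ Finset.univ, r i = r (σ i) :=
        (Finset.sum_eq_sum_iff_of_le fun i _ => h i).1 (Equiv.sum_comp σ r).symm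
      exact Finset.prod_nonneg fun i hi => by rw [h1 _ _ (heq i hi).symm]; exact zero_le_one
  · exact Finset.prod_pos fun i _ => (h1 _ i rfl).symm ▸ zero_lt_one

end Matrix

/-! ### From list weightings to nilpotent substitutions. -/

namespace MvPolynomial

/-- Taking a constant from a factor lowers the degree, so the top-degree part does not see the
constants. They will be differences of vertex weights. -/
theorem coeff_prod_add_C {σ I R : Type*} [CommSemiring R] (s : Finset I)
    (l : I → MvPolynomial σ R) (hl : ∀ i, (l i).IsHomogeneous 1) (c : I → R) (K : σ →₀ ℕ)
    (hK : K.degree = s.card) : coeff K (∏ i ∈ s, (l i + C (c i))) = coeff K (∏ i ∈ s, l i) := by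
  classical
  rw [Finset.prod_add, coeff_sum, Finset.sum_eq_single s]
  · simp
  · intro T hT hne
    have hlt : T.card < s.card :=
      Finset.card_lt_card ((Finset.mem_powerset.1 hT).ssubset_of_ne hne)
    rw [← map_prod, mul_comm, coeff_C_mul,
      (IsHomogeneous.prod T l (fun _ => 1) fun i _ => hl i).coeff_eq_zero, mul_zero]
    simp only [Finset.sum_const, smul_eq_mul, mul_one]
    omega
  · intro h
    exact absurd (Finset.mem_powerset.2 (Finset.Subset.refl s)) h

end MvPolynomial

namespace SimpleGraph

open MvPolynomial

/-- If the edge-difference polynomial of `G` does not vanish at some family of elements with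
vanishing fifth powers, then `G` is total weight `(1, 5)`-choosable. -/
theorem totalWeightPairChoosable_of_nilpotent {V S I : Type*} [Fintype V] [DecidableEq V]
    (G : SimpleGraph V) [DecidableRel G.Adj] [CommRing S] [Algebra ℝ S] (η : G.edgeSet → S)
    (hη : ∀ e, η e ^ 5 = 0) [Fintype I] (p q : I → V)
    (hI : ∀ u v, G.Adj u v → ∃ i, p i = u ∧ q i = v ∨ p i = v ∧ q i = u)
    (hne : ∏ i, ((∑ e with q i ∈ e.1, η e) - ∑ e with p i ∈ e.1, η e) ≠ 0) :
    G.TotalWeightPairChoosable 1 5 := by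
  intro L hL
  have hw : ∀ v, ∃ w, L (Sum.inl v) = {w} := fun v => Finset.card_eq_one.1 (hL (Sum.inl v))
  choose w hw using hw
  let l : I → MvPolynomial G.edgeSet ℝ := fun i =>
    (∑ e with q i ∈ e.1, X e) - ∑ e with p i ∈ e.1, X e
  have hl : ∀ i, (l i).IsHomogeneous 1 := fun i =>
    (IsHomogeneous.sum _ _ _ fun e _ => isHomogeneous_X ℝ e).sub
      (IsHomogeneous.sum _ _ _ fun e _ => isHomogeneous_X ℝ e)
  have hQ : aeval η (∏ i, l i) ≠ 0 := by
    simpa only [l, map_prod, map_sub, map_sum, aeval_X] using hne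
  -- Otherwise every monomial contains a fifth power of some variable and is killed by the
  -- substitution.
  obtain ⟨K, hK, hK5⟩ : ∃ K, coeff K (∏ i, l i) ≠ 0 ∧ ∀ e, K e < 5 := by
    by_contra! hcon
    apply hQ
    rw [aeval_def, eval₂_eq']
    refine Finset.sum_eq_zero fun K hK => ?_
    obtain ⟨e, he⟩ := hcon K (mem_support_iff.1 hK)
    rw [Finset.prod_eq_zero (Finset.mem_univ e), mul_zero]
    exact pow_eq_zero_of_le he (hη e)
  have hdeg : K.degree = (Finset.univ : Finset I).card := by
    by_contra hcon
    exact hK ((IsHomogeneous.prod Finset.univ l (fun _ => 1) fun i _ => hl i).coeff_eq_zero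
      (by simpa using hcon))
  set f : MvPolynomial G.edgeSet ℝ := ∏ i, (l i + C (w (q i) - w (p i))) with hf
  have hfK : coeff K f ≠ 0 := by
    rw [hf, coeff_prod_add_C _ _ hl _ _ hdeg]
    exact hK
  have hfdeg : f.totalDegree = K.degree := by
    refine le_antisymm ?_ ?_
    · rw [hdeg, Finset.card_eq_sum_ones]
      refine (totalDegree_finsetProd _ _).trans (Finset.sum_le_sum fun i _ => ?_)
      refine (totalDegree_add _ _).trans (max_le (hl i).totalDegree_le ?_)
      rw [totalDegree_C]
      exact zero_le_one
    · have := le_totalDegree (mem_support_iff.2 hfK)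
      exact this
  obtain ⟨x, hx, hxf⟩ := combinatorial_nullstellensatz_exists_eval_nonzero f K hfK hfdeg
    (fun e => L (Sum.inr e)) fun e => by rw [hL]; exact hK5 e
  refine ⟨Sum.elim w x, ?_, ?_⟩
  · rintro (v | e)
    · simp [hw]
    · exact hx e
  · have hne' : ∀ i, G.weightedSum (Sum.elim w x) (p i) ≠ G.weightedSum (Sum.elim w x) (q i) := by
      intro i hi
      rw [hf, map_prod] at hxf
      apply Finset.prod_ne_zero_iff.1 hxf i (Finset.mem_univ i)
      simp only [weightedSum, Sum.elim_inr, Sum.elim_inl] at hi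
      simp only [l, map_add, map_sub, map_sum, eval_X, eval_C]
      linarith
    intro u v huv
    obtain ⟨i, ⟨rfl, rfl⟩ | ⟨rfl, rfl⟩⟩ := hI u v huv
    · exact hne' i
    · exact (hne' i).symm

/-- The sum of the values of `z` on the edges of `G` incident to `v`. -/
def boundary {V : Type*} [Fintype V] [DecidableEq V] (G : SimpleGraph V) [DecidableRel G.Adj]
    (z : Sym2 V → ℝ) (v : V) : ℝ :=
  ∑ e : G.edgeSet with v ∈ e.1, z e.1

end SimpleGraph

/-! ### The certificate. -/

namespace MvPolynomial

/-- The permanent is a positive multiple of one coefficient of the product of the forms. The factor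
`Bool` makes each two-term form occur twice, so the product is a square times a monomial, and the
rows `a` select exactly the middle exponent of the square. -/
theorem permanent_square_forms_ne_zero {M P V : Type*} [Fintype M] [DecidableEq M] [Fintype P]
    [DecidableEq P] [Fintype V] [DecidableEq V] (α β : M → V) (hαβ : ∀ μ, α μ ≠ β μ) (s : M → ℝ)
    (hs : ∀ μ, s μ = 1 ∨ s μ = -1) (γ : P → V) (g : (M × Bool) ⊕ P → V → ℝ)
    (hM : ∀ μ i v, g (Sum.inl (μ, i)) v = (if v = α μ then 1 else 0) + s μ * if v = β μ then 1 else 0)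
    (hP : ∀ p v, g (Sum.inr p) v = if v = γ p then 1 else 0)
    (a : (M × Bool) ⊕ P → V)
    (ha : a = Sum.elim (fun x => if x.2 then β x.1 else α x.1) γ) :
    Matrix.permanent (Matrix.of fun i j => g j (a i)) ≠ 0 := by
  have h1 : Matrix.permanent (Matrix.of fun i j => g j (a i)) =
      ∑ σ : Equiv.Perm ((M × Bool) ⊕ P), ∏ j, g j (a (σ j)) := rfl
  rw [h1, ← card_stabilizer_mul_coeff_prod_linear]
  refine mul_ne_zero (Nat.cast_ne_zero.2 (Finset.card_ne_zero.2 ⟨1, ?_⟩)) ?_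
  · simp only [Finset.mem_filter, Finset.mem_univ, true_and]
    rfl
  have h2 : ∏ j, ∑ v, C (g j v) * X v = ((∏ μ, (X (α μ) + C (s μ) * X (β μ))) *
      ∏ μ, (X (α μ) + C (s μ) * X (β μ)) : MvPolynomial V ℝ) *
        monomial (∑ p, Finsupp.single (γ p) 1) 1 := by
    rw [Fintype.prod_sum_type, Fintype.prod_prod_type, ← Finset.prod_mul_distrib,
      monomial_sum_one]
    congr 1
    · refine Finset.prod_congr rfl fun μ _ => ?_
      have : ∀ i, ∑ v, C (g (Sum.inl (μ, i)) v) * X v =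
          (X (α μ) + C (s μ) * X (β μ) : MvPolynomial V ℝ) := by
        intro i
        simp [hM, add_mul, Finset.sum_add_distrib, apply_ite C, ite_mul]
      rw [Fintype.prod_bool, this, this]
    · refine Finset.prod_congr rfl fun p _ => ?_
      simp [hP, apply_ite C, ite_mul, X]
  have h3 : ∑ j, Finsupp.single (a j) 1 =
      ∑ μ, (Finsupp.single (α μ) 1 + Finsupp.single (β μ) 1) +
        ∑ p, Finsupp.single (γ p) (1 : ℕ) := by
    rw [Fintype.sum_sum_type, Fintype.sum_prod_type, ha]
    simp [add_comm]
  rw [h2, h3, coeff_mul_monomial, mul_one]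
  exact coeff_mul_self_ne_zero α β hαβ s hs

end MvPolynomial

namespace SimpleGraph

open MvPolynomial

/-- A certificate for total weight `(1, 5)`-choosability: `A` is independent, every edge `(u, w)`
outside `A` carries a combination of edges whose boundary has leading vertex `w`, each `μ : M`
carries a combination of edges with boundary `±α μ ± β μ` in `A`, each `p : P` carries one with
boundary a single vertex of `A`, every edge `(b, a)` meeting `A` owns one of the ends of these, and
every edge of `G` is used at most four times, the elements of `M` counting twice. -/
theorem totalWeightPairChoosable_of_forms {V M P : Type*} [Fintype V] [DecidableEq V]
    (G : SimpleGraph V) [DecidableRel G.Adj] [Fintype M] [Fintype P] (A : Finset V) (rk : V → ℕ)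
    (hA : ∀ u ∈ A, ∀ v ∈ A, ¬ G.Adj u v) (hrk : Function.Injective rk)
    (B : Finset (V × V))
    (hB : ∀ x, x ∈ B ↔ x.1 ∉ A ∧ x.2 ∉ A ∧ G.Adj x.1 x.2 ∧ rk x.1 < rk x.2)
    (zB : V × V → Sym2 V → ℝ) (hzB1 : ∀ x ∈ B, G.boundary (zB x) x.2 = 1)
    (hzB0 : ∀ x ∈ B, ∀ v ∉ A, rk v < rk x.2 → G.boundary (zB x) v = 0)
    (α β : M → V) (hα : ∀ μ, α μ ∈ A) (hβ : ∀ μ, β μ ∈ A) (hαβ : ∀ μ, α μ ≠ β μ) (s : M → ℝ)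
    (hs : ∀ μ, s μ = 1 ∨ s μ = -1) (zM : M → Sym2 V → ℝ)
    (hzM : ∀ μ v, G.boundary (zM μ) v = (if v = α μ then 1 else 0) + s μ * if v = β μ then 1 else 0)
    (γ : P → V) (hγ : ∀ p, γ p ∈ A) (zP : P → Sym2 V → ℝ)
    (hzP : ∀ p v, G.boundary (zP p) v = if v = γ p then 1 else 0)
    (tα tβ : M → V) (tγ : P → V)
    (hcover : ∀ b ∉ A, ∀ a ∈ A, G.Adj b a → (∃ μ, α μ = a ∧ tα μ = b) ∨
      (∃ μ, β μ = a ∧ tβ μ = b) ∨ ∃ p, γ p = a ∧ tγ p = b)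
    (husage : ∀ e ∈ G.edgeSet, (B.filter fun x => zB x e ≠ 0).card +
      2 * (Finset.univ.filter fun μ => zM μ e ≠ 0).card +
      (Finset.univ.filter fun p => zP p e ≠ 0).card ≤ 4) :
    G.TotalWeightPairChoosable 1 5 := by
  classical
  let JA := (M × Bool) ⊕ P
  let J := B ⊕ JA
  let zA : JA → Sym2 V → ℝ := Sum.elim (fun x => zM x.1) zP
  let z : J → Sym2 V → ℝ := Sum.elim (fun x => zB x.1) zA
  let en : JA → V := Sum.elim (fun x => if x.2 then β x.1 else α x.1) γ
  let tag : JA → V := Sum.elim (fun x => if x.2 then tβ x.1 else tα x.1) tγ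
  let EA := {x : V × V // x.1 ∉ A ∧ x.2 ∈ A ∧ G.Adj x.1 x.2}
  have hι : ∀ x : EA, ∃ j : JA, en j = x.1.2 ∧ tag j = x.1.1 := by
    rintro ⟨⟨b, a⟩, hb, ha, hba⟩
    rcases hcover b hb a ha hba with ⟨μ, h⟩ | ⟨μ, h⟩ | ⟨p, h⟩
    · exact ⟨Sum.inl (μ, false), h⟩
    · exact ⟨Sum.inl (μ, true), h⟩
    · exact ⟨Sum.inr p, h⟩
  choose ι hι1 hι2 using hι
  have hιinj : Function.Injective ι := fun x y h =>
    Subtype.ext (Prod.ext (by rw [← hι2, ← hι2, h]) (by rw [← hι1, ← hι1, h]))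
  have hzA0 : ∀ j : JA, ∀ v ∉ A, G.boundary (zA j) v = 0 := by
    rintro (⟨μ, i⟩ | p) v hv
    · simp only [zA, Sum.elim_inl]
      rw [hzM, if_neg (fun h : v = α μ => hv (h ▸ hα μ)),
        if_neg (fun h : v = β μ => hv (h ▸ hβ μ))]
      simp
    · simp only [zA, Sum.elim_inr]
      rw [hzP, if_neg (fun h : v = γ p => hv (h ▸ hγ p))]
  let I : Ideal (MvPolynomial J ℝ) := Ideal.span (Set.range fun j : J => X j ^ 2)
  let η : G.edgeSet → MvPolynomial J ℝ ⧸ I := fun e =>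
    Ideal.Quotient.mk I (∑ j, C (z j e.1) * X j)
  let Λ : V → MvPolynomial J ℝ := fun v => ∑ j, C (G.boundary (z j) v) * X j
  have hΛ : ∀ v, ∑ e with v ∈ e.1, η e = Ideal.Quotient.mk I (Λ v) := by
    intro v
    simp only [η, Λ, boundary, ← map_sum]
    rw [Finset.sum_comm]
    simp only [map_sum, Finset.sum_mul]
  refine G.totalWeightPairChoosable_of_nilpotent η ?_
    (Sum.elim (fun x : B => x.1.1) fun x : EA => x.1.1)
    (Sum.elim (fun x : B => x.1.2) fun x : EA => x.1.2) ?_ ?_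
  · intro e
    have h1 : η e = ∑ j ∈ Finset.univ.filter (fun j => z j e.1 ≠ 0),
        Ideal.Quotient.mk I (C (z j e.1) * X j) := by
      simp only [η, map_sum]
      symm
      refine Finset.sum_filter_of_ne fun j _ h h0 => h ?_
      rw [h0]
      simp
    rw [h1]
    refine pow_eq_zero_of_le ?_ (sum_pow_card_succ_eq_zero _ _ fun j _ => ?_)
    · have hcard : (Finset.univ.filter fun j => z j e.1 ≠ 0).card =
          (B.filter fun x => zB x e.1 ≠ 0).card +
          2 * (Finset.univ.filter fun μ => zM μ e.1 ≠ 0).card +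
          (Finset.univ.filter fun p => zP p e.1 ≠ 0).card := by
        simp only [Finset.card_filter, J, JA, Fintype.sum_sum_type, Fintype.sum_prod_type, z, zA,
          Sum.elim_inl, Sum.elim_inr, Fintype.sum_bool, Finset.mul_sum, two_mul]
        rw [← Finset.sum_coe_sort B, add_assoc]
        congr!
      have := husage e.1 e.2
      omega
    · have hX : Ideal.Quotient.mk I (X j ^ 2) = 0 :=
        Ideal.Quotient.eq_zero_iff_mem.2 (Ideal.subset_span ⟨j, rfl⟩)
      rw [← map_pow, mul_pow, map_mul, hX, mul_zero]
  · intro u v huv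
    by_cases hu : u ∈ A
    · have hv : v ∉ A := fun h => hA u hu v h huv
      exact ⟨Sum.inr ⟨(v, u), hv, hu, huv.symm⟩, Or.inr ⟨rfl, rfl⟩⟩
    · by_cases hv : v ∈ A
      · exact ⟨Sum.inr ⟨(u, v), hu, hv, huv⟩, Or.inl ⟨rfl, rfl⟩⟩
      · rcases lt_or_gt_of_ne (hrk.ne huv.ne) with h | h
        · exact ⟨Sum.inl ⟨(u, v), (hB _).2 ⟨hu, hv, huv, h⟩⟩, Or.inl ⟨rfl, rfl⟩⟩
        · exact ⟨Sum.inl ⟨(v, u), (hB _).2 ⟨hv, hu, huv.symm, h⟩⟩, Or.inr ⟨rfl, rfl⟩⟩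
  · simp only [hΛ, ← map_sub]
    rw [← map_prod]
    intro h0
    -- There may be more forms in `JA` than edges meeting `A`. Rows owned by no edge are filled with
    -- the form at `en i`; this multiplies the product by further factors, so it stays in the ideal
    -- if it was there.
    let m : Matrix J J ℝ := Matrix.of fun i j => Sum.elim
      (fun x : B => G.boundary (z j) x.1.2 - G.boundary (z j) x.1.1)
      (fun i : JA => if ∃ x, ι x = i then G.boundary (z j) (en i) - G.boundary (z j) (tag i)
        else G.boundary (z j) (en i)) i
    have hrow1 : ∀ x : B, ∑ j, C (m (Sum.inl x) j) * X j = Λ x.1.2 - Λ x.1.1 := by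
      intro x
      simp only [m, Λ, Matrix.of_apply, Sum.elim_inl, map_sub, sub_mul, Finset.sum_sub_distrib]
    have hrow2 : ∀ x : EA, ∑ j, C (m (Sum.inr (ι x)) j) * X j = Λ x.1.2 - Λ x.1.1 := by
      intro x
      simp only [m, Λ, Matrix.of_apply, Sum.elim_inr, map_sub, sub_mul, Finset.sum_sub_distrib,
        exists_apply_eq_apply, if_true, hι1, hι2]
    have hmem : (∏ i, ∑ j, C (m i j) * X j) ∈ I := by
      rw [Ideal.Quotient.eq_zero_iff_mem, Fintype.prod_sum_type] at h0
      refine Ideal.mem_of_dvd _ ?_ h0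
      rw [Fintype.prod_sum_type]
      refine mul_dvd_mul (dvd_of_eq ?_) ?_
      · simp only [hrow1, Sum.elim_inl]
      · have : ∏ x : EA, (Λ x.1.2 - Λ x.1.1) =
            ∏ i ∈ Finset.univ.map ⟨ι, hιinj⟩, ∑ j, C (m (Sum.inr i) j) * X j := by
          rw [Finset.prod_map]
          simp only [Function.Embedding.coeFn_mk, hrow2]
        simp only [Sum.elim_inr]
        rw [this]
        exact Finset.prod_dvd_prod_of_subset _ _ _ (Finset.subset_univ _)
    have hcoeff := coeff_sum_single_eq_zero_of_mem hmem
    rw [coeff_prod_linear_eq_permanent] at hcoeff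
    -- The vectors `zA j` have no boundary outside `A`, which gives the zero block and also removes
    -- the `tag` terms from the last block.
    have hblock : m = Matrix.fromBlocks
        (Matrix.of fun x y : B => G.boundary (zB y.1) x.1.2 - G.boundary (zB y.1) x.1.1) 0
        (Matrix.of fun i (y : B) => m (Sum.inr i) (Sum.inl y))
        (Matrix.of fun i j : JA => G.boundary (zA j) (en i)) := by
      ext (x | i) (y | j)
      · rfl
      · have hx := (hB x.1).1 x.2
        simp [m, z, hzA0 j _ hx.1, hzA0 j _ hx.2.1]
      · rfl
      · simp only [m, Matrix.of_apply, Sum.elim_inr, Matrix.fromBlocks_apply₂₂, z]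
        split_ifs with h
        · obtain ⟨x, rfl⟩ := h
          rw [hzA0 j (tag (ι x)) (hι2 x ▸ x.2.1), sub_zero]
        · rfl
    rw [hblock, Matrix.permanent_fromBlocks_zero₁₂] at hcoeff
    refine mul_ne_zero ?_ ?_ hcoeff
    · refine Matrix.permanent_ne_zero_of_rank _ (fun x => rk x.1.2) ?_ ?_
      · intro x y hxy
        have hx := (hB x.1).1 x.2
        simp only [Matrix.of_apply]
        rw [hzB0 y.1 y.2 _ hx.2.1 hxy, hzB0 y.1 y.2 _ hx.1 (hx.2.2.2.trans hxy), sub_zero]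
      · intro x y hxy
        have hx := (hB x.1).1 x.2
        have hxy' : rk x.1.1 < rk y.1.2 := hxy ▸ hx.2.2.2
        simp only [Matrix.of_apply]
        rw [hzB0 y.1 y.2 _ hx.1 hxy', hrk hxy, hzB1 y.1 y.2, sub_zero]
    · refine permanent_square_forms_ne_zero α β hαβ s hs γ (fun j => G.boundary (zA j))
        ?_ ?_ en rfl
      · intro μ i v
        exact hzM μ v
      · intro p v
        exact hzP p v

end SimpleGraph

/-! ### Forests and pairings. -/

/-- In a rooted forest, the vertices of `X` can be grouped into disjoint pairs consisting of a
vertex and its parent or of two siblings. -/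
theorem exists_sibling_pairing {V : Type*} [DecidableEq V] (par : V → V) (dep : V → ℕ)
    (X : Finset V) (h : ∀ x ∈ X, dep x = dep (par x) + 1) :
    ∃ M : Finset (V × V),
      (∀ m ∈ M, m.1 ∈ X ∧ m.1 ≠ m.2 ∧ (m.2 = par m.1 ∨ m.2 ∈ X ∧ par m.2 = par m.1)) ∧
      (∀ x ∈ X, ∃ m ∈ M, m.1 = x ∨ m.2 = x) ∧
      ∀ v, ∀ m ∈ M, ∀ m' ∈ M, (m.1 = v ∨ m.2 = v) → (m'.1 = v ∨ m'.2 = v) → m = m' := by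
  induction X using Finset.strongInduction with
  | H X ih =>
    rcases X.eq_empty_or_nonempty with rfl | hne
    · exact ⟨∅, by simp⟩
    obtain ⟨x, hx, hmax⟩ := Finset.exists_max_image X dep hne
    -- A deepest `x` is paired with a sibling if there is one, otherwise with its parent. Either way
    -- no other vertex of `X` has its parent in the pair, so the pair can be removed.
    obtain ⟨y, hxy, hy, hy'⟩ : ∃ y, x ≠ y ∧ (y = par x ∨ y ∈ X ∧ par y = par x) ∧
        ∀ w ∈ X, w ≠ x → w ≠ y → par w ≠ x ∧ par w ≠ y := by
      have hnx : ∀ w ∈ X, par w ≠ x := fun w hw hwx => by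
        have := h w hw; have := hmax w hw; rw [hwx] at *; omega
      by_cases hs : ∃ y ∈ X, y ≠ x ∧ par y = par x
      · obtain ⟨y, hyX, hyx, hpy⟩ := hs
        refine ⟨y, hyx.symm, Or.inr ⟨hyX, hpy⟩, fun w hw _ _ => ⟨hnx w hw, fun hwy => ?_⟩⟩
        have := h w hw
        have := hmax w hw
        have := h x hx
        have := h y hyX
        rw [hwy, hpy] at *
        omega
      · push Not at hs
        refine ⟨par x, fun hh => ?_, Or.inl rfl, fun w hw hwx _ => ⟨hnx w hw, hs w hw hwx⟩⟩
        have := h x hx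
        rw [← hh] at this
        omega
    have hss : X \ {x, y} ⊂ X :=
      Finset.ssubset_iff_subset_ne.2 ⟨Finset.sdiff_subset, fun hh => by
        have := hh.symm ▸ hx
        simp at this⟩
    obtain ⟨M, hM1, hM2, hM3⟩ := ih _ hss fun z hz => h z (Finset.sdiff_subset hz)
    have hav : ∀ m ∈ M, ∀ v, (m.1 = v ∨ m.2 = v) → v ≠ x ∧ v ≠ y := by
      intro m hm v hv
      obtain ⟨h1, -, h2⟩ := hM1 m hm
      simp only [Finset.mem_sdiff, Finset.mem_insert, Finset.mem_singleton, not_or] at h1 h2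
      rcases hv with rfl | rfl
      · exact h1.2
      · rcases h2 with h2 | h2
        · rw [h2]
          exact hy' _ h1.1 h1.2.1 h1.2.2
        · exact h2.1.2
    refine ⟨insert (x, y) M, ?_, ?_, ?_⟩
    · intro m hm
      rcases Finset.mem_insert.1 hm with rfl | hm
      · exact ⟨hx, hxy, hy⟩
      · obtain ⟨h1, h2, h3⟩ := hM1 m hm
        exact ⟨Finset.sdiff_subset h1, h2, h3.imp_right fun h => ⟨Finset.sdiff_subset h.1, h.2⟩⟩
    · intro z hz
      by_cases hzx : z = x
      · exact ⟨_, Finset.mem_insert_self _ _, Or.inl hzx.symm⟩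
      by_cases hzy : z = y
      · exact ⟨_, Finset.mem_insert_self _ _, Or.inr hzy.symm⟩
      obtain ⟨m, hm, hmz⟩ := hM2 z (by simp [hz, hzx, hzy])
      exact ⟨m, Finset.mem_insert_of_mem hm, hmz⟩
    · intro v m hm m' hm' hv hv'
      rcases Finset.mem_insert.1 hm with rfl | hm <;> rcases Finset.mem_insert.1 hm' with rfl | hm'
      · rfl
      · have := hav m' hm' v hv'
        rcases hv with rfl | rfl
        · exact absurd rfl this.1
        · exact absurd rfl this.2
      · have := hav m hm v hv
        rcases hv' with rfl | rfl
        · exact absurd rfl this.1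
        · exact absurd rfl this.2
      · exact hM3 v m hm m' hm' hv hv'

namespace SimpleGraph

/-- If every nonempty subset of `X` has an edge leaving it inside `X ∪ Y`, then `X` is spanned by a
forest rooted in `Y`. -/
theorem exists_forest {V : Type*} [DecidableEq V] (Γ : SimpleGraph V) (X Y : Finset V)
    (hXY : Disjoint X Y)
    (H : ∀ Z ⊆ X, Z.Nonempty → ∃ z ∈ Z, ∃ v ∈ X ∪ Y, v ∉ Z ∧ Γ.Adj z v) :
    ∃ (par : V → V) (dep : V → ℕ),
      ∀ x ∈ X, Γ.Adj x (par x) ∧ par x ∈ X ∪ Y ∧ dep x = dep (par x) + 1 := by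
  -- The forest grows by one vertex at a time: the exit from `X \ W` leads to a vertex already
  -- reached or to a root.
  suffices ∀ n, n ≤ X.card → ∃ W ⊆ X, W.card = n ∧ ∃ (par : V → V) (dep : V → ℕ),
      ∀ x ∈ W, Γ.Adj x (par x) ∧ par x ∈ W ∪ Y ∧ dep x = dep (par x) + 1 by
    obtain ⟨W, hW, hc, hh⟩ := this X.card le_rfl
    rwa [Finset.eq_of_subset_of_card_le hW hc.ge] at hh
  intro n
  induction n with
  | zero => exact fun _ => ⟨∅, by simp, rfl, id, fun _ => 0, by simp⟩
  | succ n ih =>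
    intro hn
    obtain ⟨W, hW, hc, par, dep, hh⟩ := ih (by omega)
    have hne : (X \ W).Nonempty := by
      rw [← Finset.card_pos, Finset.card_sdiff_of_subset hW]
      omega
    obtain ⟨z, hz, v, hv, hvZ, hzv⟩ := H _ Finset.sdiff_subset hne
    obtain ⟨hzX, hzW⟩ := Finset.mem_sdiff.1 hz
    have hvW : v ∈ W ∪ Y := by
      simp only [Finset.mem_union, Finset.mem_sdiff, not_and, not_not] at hv hvZ ⊢
      exact hv.imp_left hvZ
    have hzWY : z ∉ W ∪ Y := by
      rw [Finset.mem_union, not_or]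
      exact ⟨hzW, Finset.disjoint_left.1 hXY hzX⟩
    refine ⟨insert z W, Finset.insert_subset hzX hW, by rw [Finset.card_insert_of_notMem hzW, hc],
      Function.update par z v, Function.update dep z (dep v + 1), fun x hx => ?_⟩
    have hmono : ∀ w ∈ W ∪ Y, w ∈ insert z W ∪ Y := fun w hw =>
      Finset.union_subset_union_left (Finset.subset_insert z W) hw
    rcases Finset.mem_insert.1 hx with rfl | hx
    · simp only [Function.update_self]
      exact ⟨hzv, hmono v hvW, by rw [Function.update_of_ne hzv.ne']⟩
    · obtain ⟨h1, h2, h3⟩ := hh x hx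
      have hxz : x ≠ z := fun e => hzW (e ▸ hx)
      have hpz : par x ≠ z := fun e => hzWY (e ▸ h2)
      rw [Function.update_of_ne hxz, Function.update_of_ne hxz, Function.update_of_ne hpz]
      exact ⟨h1, hmono _ h2, h3⟩

/-- Every connected component with an edge contains an edge `ℓ r` such that all vertices other
than `ℓ` are joined to `r` avoiding `ℓ`. -/
theorem ConnectedComponent.exists_adj_forall_exit {V : Type*} [Finite V] {Γ : SimpleGraph V}
    (κ : Γ.ConnectedComponent) (hκ : ∃ a b, Γ.connectedComponentMk a = κ ∧ Γ.Adj a b) :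
    ∃ ℓ r, Γ.connectedComponentMk ℓ = κ ∧ Γ.Adj ℓ r ∧
      ∀ Z : Set V, r ∉ Z → ℓ ∉ Z → (∃ x ∈ Z, Γ.connectedComponentMk x = κ) →
        ∃ z ∈ Z, ∃ v ∉ Z, v ≠ ℓ ∧ Γ.Adj z v ∧ Γ.connectedComponentMk v = κ := by
  obtain ⟨a, b, ha, hab⟩ := hκ
  have hb : Γ.connectedComponentMk b = κ := by
    rw [← ha]; exact (ConnectedComponent.sound hab.reachable).symm
  have : Nontrivial κ := ⟨⟨a, ha⟩, ⟨b, hb⟩, fun h => hab.ne (congrArg Subtype.val h)⟩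
  -- `ℓ` is a non-cut vertex of the component, and `r` is any neighbour of it.
  obtain ⟨⟨ℓ, hℓ⟩, hconn⟩ :=
    κ.connected_toSimpleGraph.exists_connected_induce_compl_singleton_of_finite_nontrivial
  obtain ⟨⟨r, hrκ⟩, hr⟩ := κ.connected_toSimpleGraph.preconnected.exists_adj_of_nontrivial ⟨ℓ, hℓ⟩
  refine ⟨ℓ, r, hℓ, hr, fun Z hrZ hℓZ ⟨x, hxZ, hx⟩ => ?_⟩
  obtain ⟨p⟩ := hconn.preconnected
    ⟨⟨x, hx⟩, fun h => hℓZ ((show x = ℓ from congrArg Subtype.val h) ▸ hxZ)⟩ ⟨⟨r, hrκ⟩, fun h => hr.ne h.symm⟩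
  obtain ⟨d, -, hd1, hd2⟩ := p.exists_boundary_dart {y | y.1.1 ∈ Z} hxZ hrZ
  exact ⟨d.fst.1.1, hd1, d.snd.1.1, hd2, fun h => d.snd.2 (Subtype.ext h), d.adj, d.snd.1.2⟩

/-- Pairing of a set `D` of nonisolated vertices along edge-disjoint paths of length at most two:
`par` selects distinct edges at the vertices of `D'`, every pair of `M` is joined by one of these
edges or by two of them with a common endpoint, and only the vertices of the independent set `R`
lie in two pairs. -/
theorem exists_pairing {V : Type*} [Fintype V] [DecidableEq V] (Γ : SimpleGraph V) (D : Finset V)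
    (hD : ∀ b ∈ D, ∃ c, Γ.Adj b c) :
    ∃ (R D' : Finset V) (par : V → V) (M : Finset (V × V)),
      R ⊆ D ∧ (∀ r ∈ R, ∀ r' ∈ R, ¬ Γ.Adj r r') ∧ D' ⊆ D ∧ Disjoint D' R ∧
      (∀ x ∈ D', Γ.Adj x (par x)) ∧
      (∀ x ∈ D', ∀ x' ∈ D', s(x, par x) = s(x', par x') → x = x') ∧
      (∀ m ∈ M, m.1 ∈ D' ∧ m.1 ≠ m.2 ∧ (m.2 = par m.1 ∨ m.2 ∈ D' ∧ par m.2 = par m.1)) ∧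
      (∀ b ∈ D, ∃ m ∈ M, m.1 = b ∨ m.2 = b) ∧
      (∀ v ∉ R, ∀ m ∈ M, ∀ m' ∈ M, (m.1 = v ∨ m.2 = v) → (m'.1 = v ∨ m'.2 = v) → m = m') ∧
      ∀ v, (M.filter fun m => m.1 = v ∨ m.2 = v).card ≤ 2 := by
  classical
  -- A component with a vertex outside `D` can be rooted there, where nothing needs covering. A pure
  -- one is rooted at `rr κ`, with `ll κ` set aside so that the edge between the two covers both.
  -- The root may then lie in a second pair, as a parent.
  let pure : Γ.ConnectedComponent → Prop := fun κ => ∀ v, Γ.connectedComponentMk v = κ → v ∈ D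
  have hex : ∀ κ : Γ.ConnectedComponent, ∃ ℓ r, pure κ →
      Γ.connectedComponentMk ℓ = κ ∧ Γ.Adj ℓ r ∧
      ∀ Z : Set V, r ∉ Z → ℓ ∉ Z → (∃ x ∈ Z, Γ.connectedComponentMk x = κ) →
        ∃ z ∈ Z, ∃ v ∉ Z, v ≠ ℓ ∧ Γ.Adj z v ∧ Γ.connectedComponentMk v = κ := by
    intro κ
    obtain ⟨a, ha⟩ := κ.exists_rep
    by_cases hκ : pure κ
    · obtain ⟨b, hab⟩ := hD a (hκ a ha)
      obtain ⟨ℓ, r, h⟩ := κ.exists_adj_forall_exit ⟨a, b, ha, hab⟩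
      exact ⟨ℓ, r, fun _ => h⟩
    · exact ⟨a, a, fun h => absurd h hκ⟩
  choose ll rr hlr using hex
  have hrκ : ∀ κ, pure κ → Γ.connectedComponentMk (rr κ) = κ := fun κ h => by
    rw [← ConnectedComponent.sound (hlr κ h).2.1.reachable, (hlr κ h).1]
  let L : Finset V := Finset.univ.filter fun v => ∃ κ, pure κ ∧ v = ll κ
  let R : Finset V := Finset.univ.filter fun v => ∃ κ, pure κ ∧ v = rr κ
  have hL : ∀ v ∈ L, pure (Γ.connectedComponentMk v) ∧ v = ll (Γ.connectedComponentMk v) := by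
    intro v hv
    obtain ⟨κ, hκ, rfl⟩ := (Finset.mem_filter.1 hv).2
    rw [(hlr κ hκ).1]
    exact ⟨hκ, rfl⟩
  have hR : ∀ v ∈ R, pure (Γ.connectedComponentMk v) ∧ v = rr (Γ.connectedComponentMk v) := by
    intro v hv
    obtain ⟨κ, hκ, rfl⟩ := (Finset.mem_filter.1 hv).2
    rw [hrκ κ hκ]
    exact ⟨hκ, rfl⟩
  have hLR : ∀ v ∈ L, v ∉ R := fun v hv hv' => by
    have h1 := hL v hv
    have h2 := hR v hv'
    have := (hlr _ h1.1).2.1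
    rw [← h1.2, ← h2.2] at this
    exact this.ne rfl
  have hrrR : ∀ v ∈ L, rr (Γ.connectedComponentMk v) ∈ R := fun v hv =>
    Finset.mem_filter.2 ⟨Finset.mem_univ _, _, (hL v hv).1, rfl⟩
  let X : Finset V := D \ (L ∪ R)
  -- The admissible roots are the vertices of `R` and those outside `D`. Excluding `L` keeps the
  -- reserved edges out of the forest.
  let Y : Finset V := (X ∪ L)ᶜ
  have hXY : ∀ v, v ∉ L → v ∈ X ∪ Y := fun v hv => by
    by_cases h : v ∈ X
    · exact Finset.mem_union_left _ h
    · refine Finset.mem_union_right _ (Finset.mem_compl.2 fun h' => ?_)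
      exact (Finset.mem_union.1 h').elim h hv
  have hXYL : ∀ v ∈ X ∪ Y, v ∉ L := fun v hv hvL => by
    rcases Finset.mem_union.1 hv with h | h
    · exact (Finset.mem_sdiff.1 h).2 (Finset.mem_union_left _ hvL)
    · exact Finset.mem_compl.1 h (Finset.mem_union_right _ hvL)
  have hXR : ∀ v ∈ X, v ∉ R := fun v hv hvR =>
    (Finset.mem_sdiff.1 hv).2 (Finset.mem_union_right _ hvR)
  obtain ⟨par, dep, hpar⟩ := Γ.exists_forest X Y
    (Finset.disjoint_left.2 fun v hv hv' => Finset.mem_compl.1 hv' (Finset.mem_union_left _ hv)) (by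
      rintro Z hZ ⟨x, hx⟩
      set κ := Γ.connectedComponentMk x with hκ
      have hZL : ∀ z ∈ Z, z ∉ L := fun z hz => hXYL z (Finset.mem_union_left _ (hZ hz))
      by_cases hp : pure κ
      · obtain ⟨z, hz, v, hv, hvℓ, hzv, hvκ⟩ := (hlr κ hp).2.2 Z
          (fun h => hXR _ (hZ h) (Finset.mem_filter.2 ⟨Finset.mem_univ _, κ, hp, rfl⟩))
          (fun h => hZL _ h (Finset.mem_filter.2 ⟨Finset.mem_univ _, κ, hp, rfl⟩)) ⟨x, hx, rfl⟩
        refine ⟨z, hz, v, hXY v fun hvL => hvℓ ?_, hv, hzv⟩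
        rw [← hvκ]
        exact (hL v hvL).2
      · obtain ⟨y, hyκ, hyD⟩ : ∃ y, Γ.connectedComponentMk y = κ ∧ y ∉ D := by
          simpa [pure] using hp
        obtain ⟨w⟩ := ConnectedComponent.exact hyκ.symm
        obtain ⟨d, -, hd1, hd2⟩ := w.exists_boundary_dart
          {v | v ∈ Z ∧ Γ.connectedComponentMk v = κ} ⟨hx, rfl⟩
          fun h => hyD (Finset.mem_sdiff.1 (hZ h.1)).1
        have hdκ : Γ.connectedComponentMk d.snd = κ := by
          rw [← hd1.2]
          exact (ConnectedComponent.sound d.adj.reachable).symm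
        refine ⟨d.fst, hd1.1, d.snd, hXY _ fun hL' => hp ?_, fun h => hd2 ⟨h, hdκ⟩, d.adj⟩
        rw [← hdκ]
        exact (hL _ hL').1)
  obtain ⟨M, hM1, hM2, hM3⟩ := exists_sibling_pairing par dep X fun x hx => (hpar x hx).2.2
  let par' : V → V := fun v => if v ∈ L then rr (Γ.connectedComponentMk v) else par v
  have hparL : ∀ v ∈ L, par' v = rr (Γ.connectedComponentMk v) := fun v hv => if_pos hv
  have hparX : ∀ v ∈ X, par' v = par v := fun v hv =>
    if_neg (hXYL v (Finset.mem_union_left _ hv))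
  let ML : Finset (V × V) := L.image fun v => (v, par' v)
  have hML : ∀ m ∈ ML, m.1 ∈ L ∧ m.2 = par' m.1 := by
    intro m hm
    obtain ⟨v, hv, rfl⟩ := Finset.mem_image.1 hm
    exact ⟨hv, rfl⟩
  have hMLv : ∀ v, ∀ m ∈ M, (m.1 = v ∨ m.2 = v) → v ∉ L := by
    intro v m hm hv
    obtain ⟨h1, -, h2⟩ := hM1 m hm
    rcases hv with rfl | rfl
    · exact hXYL _ (Finset.mem_union_left _ h1)
    · rcases h2 with h2 | h2
      · rw [h2]; exact hXYL _ (hpar _ h1).2.1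
      · exact hXYL _ (Finset.mem_union_left _ h2.1)
  have hML2 : ∀ m ∈ ML, m.2 ∈ R := fun m hm => by
    rw [(hML m hm).2, hparL _ (hML m hm).1]
    exact hrrR _ (hML m hm).1
  have hMLinj : ∀ v, ∀ m ∈ ML, ∀ m' ∈ ML, (m.1 = v ∨ m.2 = v) → (m'.1 = v ∨ m'.2 = v) →
      m = m' := by
    have hκ : ∀ m ∈ ML, Γ.connectedComponentMk m.2 = Γ.connectedComponentMk m.1 := fun m hm => by
      rw [(hML m hm).2, hparL _ (hML m hm).1, hrκ _ (hL _ (hML m hm).1).1]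
    intro v m hm m' hm' hv hv'
    have h : Γ.connectedComponentMk m.1 = Γ.connectedComponentMk m'.1 := by
      rcases hv with rfl | rfl <;> rcases hv' with h | h
      · rw [h]
      · rw [← h, hκ m' hm']
      · rw [h, hκ m hm]
      · rw [← hκ m hm, ← h, hκ m' hm']
    have h1 : m.1 = m'.1 := by rw [(hL _ (hML m hm).1).2, h, ← (hL _ (hML m' hm').1).2]
    exact Prod.ext h1 (by rw [(hML m hm).2, (hML m' hm').2, h1])
  refine ⟨R, X ∪ L, par', M ∪ ML, ?_, ?_, ?_, ?_, ?_, ?_, ?_, ?_, ?_, ?_⟩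
  · exact fun r hr => (hR r hr).1 r rfl
  · intro r hr r' hr' hadj
    have := ConnectedComponent.sound hadj.reachable
    rw [(hR r hr).2, (hR r' hr').2, this] at hadj
    exact hadj.ne rfl
  · intro v hv
    rcases Finset.mem_union.1 hv with h | h
    · exact (Finset.mem_sdiff.1 h).1
    · exact (hL v h).1 v rfl
  · refine Finset.disjoint_left.2 fun v hv hvR => ?_
    rcases Finset.mem_union.1 hv with h | h
    · exact hXR v h hvR
    · exact hLR v h hvR
  · intro x hx
    rcases Finset.mem_union.1 hx with h | h
    · rw [hparX x h]; exact (hpar x h).1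
    · rw [hparL x h]
      have := (hlr _ (hL x h).1).2.1
      rwa [← (hL x h).2] at this
  · intro x hx x' hx' he
    rcases Sym2.eq_iff.1 he with h | ⟨h1, h2⟩
    · exact h.1
    rcases Finset.mem_union.1 hx with h | h <;> rcases Finset.mem_union.1 hx' with h' | h'
    · rw [hparX x h] at h2
      rw [hparX x' h'] at h1
      have e1 := (hpar x h).2.2
      have e2 := (hpar x' h').2.2
      rw [h2] at e1
      rw [← h1] at e2
      omega
    · exact absurd (by rw [h1, hparL x' h']; exact hrrR x' h') (hXR x h)
    · exact absurd (by rw [← h2, hparL x h]; exact hrrR x h) (hXR x' h')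
    · exact absurd (by rw [h1, hparL x' h']; exact hrrR x' h') (hLR x h)
  · intro m hm
    rcases Finset.mem_union.1 hm with hm | hm
    · obtain ⟨h1, h2, h3⟩ := hM1 m hm
      refine ⟨Finset.mem_union_left _ h1, h2, ?_⟩
      rw [hparX _ h1]
      exact h3.imp_right fun h => ⟨Finset.mem_union_left _ h.1, by rw [hparX _ h.1, h.2]⟩
    · exact ⟨Finset.mem_union_right _ (hML m hm).1,
        fun h => hLR _ (hML m hm).1 (h ▸ hML2 m hm), Or.inl (hML m hm).2⟩
  · intro b hb
    by_cases hbL : b ∈ L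
    · exact ⟨(b, par' b), Finset.mem_union_right _ (Finset.mem_image_of_mem _ hbL), Or.inl rfl⟩
    by_cases hbR : b ∈ R
    · obtain ⟨hp, hb'⟩ := hR b hbR
      have hlL : ll (Γ.connectedComponentMk b) ∈ L :=
        Finset.mem_filter.2 ⟨Finset.mem_univ _, _, hp, rfl⟩
      refine ⟨_, Finset.mem_union_right _ (Finset.mem_image_of_mem _ hlL), Or.inr ?_⟩
      rw [hparL _ hlL, (hlr _ hp).1, ← hb']
    · obtain ⟨m, hm, h⟩ := hM2 b (by simp [X, hb, hbL, hbR])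
      exact ⟨m, Finset.mem_union_left _ hm, h⟩
  · intro v hvR m hm m' hm' hv hv'
    have key : ∀ m ∈ ML, ∀ m' ∈ M, (m.1 = v ∨ m.2 = v) → (m'.1 = v ∨ m'.2 = v) → False := by
      intro m hm m' hm' hv hv'
      rcases hv with rfl | rfl
      · exact hMLv _ m' hm' hv' (hML m hm).1
      · exact hvR (hML2 m hm)
    rcases Finset.mem_union.1 hm with hm | hm <;> rcases Finset.mem_union.1 hm' with hm' | hm'
    · exact hM3 v m hm m' hm' hv hv'
    · exact (key m' hm' m hm hv' hv).elim
    · exact (key m hm m' hm' hv hv').elim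
    · exact hMLinj v m hm m' hm' hv hv'
  · intro v
    rw [Finset.filter_union]
    refine (Finset.card_union_le _ _).trans (add_le_add (b := 1) (d := 1) ?_ ?_)
    · refine Finset.card_le_one.2 fun m hm m' hm' => ?_
      rw [Finset.mem_filter] at hm hm'
      exact hM3 v m hm.1 m' hm'.1 hm.2 hm'.2
    · refine Finset.card_le_one.2 fun m hm m' hm' => ?_
      rw [Finset.mem_filter] at hm hm'
      exact hMLinj v m hm.1 m' hm'.1 hm.2 hm'.2

end SimpleGraph

/-! ### Derangements, boundaries and the independent set. -/

/-- A finset with two distinct elements `z ≠ z'` has a fixed-point-free permutation that maps `z` to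
`z'`. -/
theorem Finset.exists_perm_derangement {V : Type*} [DecidableEq V] (N : Finset V) {z z' : V}
    (hz : z ∈ N) (hz' : z' ∈ N) (hne : z ≠ z') :
    ∃ π : Equiv.Perm V, (∀ a ∈ N, π a ∈ N) ∧ (∀ a ∈ N, π a ≠ a) ∧ π z = z' := by
  obtain ⟨n, hn⟩ : ∃ n, Fintype.card N = n + 2 := by
    have : 1 < N.card := Finset.one_lt_card.2 ⟨z, hz, z', hz', hne⟩
    exact ⟨N.card - 2, by rw [Fintype.card_coe]; omega⟩
  let e : N ≃ Fin (n + 2) := Fintype.equivFinOfCardEq hn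
  let ρ : Equiv.Perm N := (e.trans (finRotate (n + 2))).trans e.symm
  have hρ : ∀ a, ρ a ≠ a := by
    intro a h
    simp [ρ, Equiv.symm_apply_eq] at h
  -- Conjugating the cyclic rotation by this transposition, which fixes `z`, redirects the image of
  -- `z` to `z'` and creates no fixed point.
  let τ : Equiv.Perm N := Equiv.swap (ρ ⟨z, hz⟩) ⟨z', hz'⟩
  have hτz : τ ⟨z, hz⟩ = ⟨z, hz⟩ :=
    Equiv.swap_apply_of_ne_of_ne (hρ _).symm fun h => hne (congrArg Subtype.val h)
  let π : Equiv.Perm N := τ⁻¹.trans (ρ.trans τ)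
  have hπ : ∀ a, π a ≠ a := by
    intro a h
    apply hρ (τ⁻¹ a)
    apply τ.injective
    simpa [π] using h
  have hπz : π ⟨z, hz⟩ = ⟨z', hz'⟩ := by
    have : τ⁻¹ ⟨z, hz⟩ = ⟨z, hz⟩ := by rw [Equiv.Perm.inv_eq_iff_eq, hτz]
    simp only [π, Equiv.trans_apply, this]
    exact Equiv.swap_apply_left _ _
  refine ⟨Equiv.Perm.ofSubtype π, fun a ha => ?_, fun a ha => ?_, ?_⟩
  · rw [Equiv.Perm.ofSubtype_apply_of_mem π ha]
    exact (π ⟨a, ha⟩).2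
  · rw [Equiv.Perm.ofSubtype_apply_of_mem π ha]
    exact fun h => hπ ⟨a, ha⟩ (Subtype.ext h)
  · rw [Equiv.Perm.ofSubtype_apply_of_mem π hz, hπz]

namespace SimpleGraph

section Boundary

variable {V : Type*} [Fintype V] [DecidableEq V] (G : SimpleGraph V) [DecidableRel G.Adj]

theorem boundary_add (z z' : Sym2 V → ℝ) (v : V) :
    G.boundary (z + z') v = G.boundary z v + G.boundary z' v := by
  simp [boundary, Finset.sum_add_distrib]

theorem boundary_sub (z z' : Sym2 V → ℝ) (v : V) :
    G.boundary (z - z') v = G.boundary z v - G.boundary z' v := by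
  simp [boundary, Finset.sum_sub_distrib]

theorem boundary_smul (c : ℝ) (z : Sym2 V → ℝ) (v : V) :
    G.boundary (c • z) v = c * G.boundary z v := by
  simp [boundary, Finset.mul_sum]

variable {G} in
theorem boundary_single {u w : V} (h : G.Adj u w) (v : V) :
    G.boundary (Pi.single s(u, w) 1) v = (if v = u then 1 else 0) + if v = w then 1 else 0 := by
  have h1 : G.boundary (Pi.single s(u, w) 1) v = if v ∈ s(u, w) then 1 else 0 := by
    rw [boundary, Finset.sum_filter, Finset.sum_eq_single ⟨s(u, w), h⟩]
    · simp
    · intro e _ he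
      rw [Pi.single_eq_of_ne fun hh => he (Subtype.ext hh), ite_self]
    · simp
  rw [h1]
  simp only [Sym2.mem_iff]
  have := h.ne
  by_cases hu : v = u <;> by_cases hw : v = w <;> simp_all

end Boundary

/-- A graph without isolated edges has a dominating independent set `A` such that the private
neighbours of every vertex of `A` form a clique, and a unique private neighbour has another
neighbour outside `A`. -/
theorem IsNice.exists_independent {V : Type*} [Fintype V] [DecidableEq V] {G : SimpleGraph V}
    [DecidableRel G.Adj] (hG : G.IsNice) :
    ∃ A : Finset V, (∀ u ∈ A, ∀ v ∈ A, ¬ G.Adj u v) ∧ (∀ b ∉ A, ∃ a ∈ A, G.Adj b a) ∧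
      (∀ b ∉ A, ∀ b' ∉ A, ∀ a ∈ A, b ≠ b' → A.filter (G.Adj b) = {a} → A.filter (G.Adj b') = {a} →
        G.Adj b b') ∧
      ∀ b ∉ A, ∀ a ∈ A, A.filter (G.Adj b) = {a} →
        (∀ b' ∉ A, A.filter (G.Adj b') = {a} → b' = b) → ∃ c ∉ A, G.Adj b c := by
  classical
  let ind : Finset (Finset V) := Finset.univ.filter fun A => ∀ u ∈ A, ∀ v ∈ A, ¬ G.Adj u v
  have hind : ∀ A, A ∈ ind ↔ ∀ u ∈ A, ∀ v ∈ A, ¬ G.Adj u v := fun A => by simp [ind]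
  obtain ⟨A₀, hA₀, hmax₀⟩ := Finset.exists_max_image ind Finset.card ⟨∅, by simp [hind]⟩
  -- Maximality alone gives domination and the cliques, by inserting vertices or exchanging one for
  -- two. The least degree sum serves only the last property.
  obtain ⟨A, hA, hmin⟩ := Finset.exists_min_image (ind.filter fun A => A.card = A₀.card)
    (fun A => ∑ a ∈ A, G.degree a) ⟨A₀, by simp [hA₀]⟩
  rw [Finset.mem_filter] at hA
  have hmax : ∀ A' ∈ ind, A'.card ≤ A.card := fun A' h => hA.2 ▸ hmax₀ A' h
  have hAi := (hind A).1 hA.1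
  have hins : ∀ A' ∈ ind, ∀ b, (∀ a ∈ A', ¬ G.Adj b a) → insert b A' ∈ ind := by
    intro A' hA' b hb
    rw [hind] at hA' ⊢
    intro u hu v hv huv
    rcases Finset.mem_insert.1 hu with rfl | hu' <;> rcases Finset.mem_insert.1 hv with rfl | hv'
    · exact huv.ne rfl
    · exact hb v hv' huv
    · exact hb u hu' huv.symm
    · exact hA' u hu' v hv' huv
  have hera : ∀ a, A.erase a ∈ ind := fun a => (hind _).2 fun u hu v hv =>
    hAi u (Finset.mem_of_mem_erase hu) v (Finset.mem_of_mem_erase hv)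
  have hpriv : ∀ b a, A.filter (G.Adj b) = {a} → ∀ a' ∈ A, G.Adj b a' → a' = a := by
    intro b a h a' ha' hba'
    exact Finset.mem_singleton.1 (h ▸ Finset.mem_filter.2 ⟨ha', hba'⟩)
  have hpriv' : ∀ b a, A.filter (G.Adj b) = {a} → G.Adj b a := by
    intro b a h
    exact (Finset.mem_filter.1 (h.symm ▸ Finset.mem_singleton_self a : a ∈ A.filter (G.Adj b))).2
  have hswap : ∀ b a, A.filter (G.Adj b) = {a} → insert b (A.erase a) ∈ ind := fun b a h =>
    hins _ (hera a) b fun a' ha' hba' =>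
      Finset.ne_of_mem_erase ha' (hpriv b a h a' (Finset.mem_of_mem_erase ha') hba')
  refine ⟨A, hAi, ?_, ?_, ?_⟩
  · intro b hb
    by_contra! hcon
    have := hmax _ (hins A hA.1 b hcon)
    rw [Finset.card_insert_of_notMem hb] at this
    omega
  · intro b hb b' hb' a ha hbb' h h'
    by_contra hadj
    have h1 := hmax _ (hins _ (hswap b a h) b' fun x hx hb'x => ?_)
    · have hbe : b ∉ A.erase a := fun h => hb (Finset.mem_of_mem_erase h)
      rw [Finset.card_insert_of_notMem, Finset.card_insert_of_notMem hbe, Finset.card_erase_of_mem ha] at h1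
      · have := Finset.card_pos.2 ⟨a, ha⟩
        omega
      · rw [Finset.mem_insert, not_or]
        exact ⟨hbb'.symm, fun h => hb' (Finset.mem_of_mem_erase h)⟩
    · rcases Finset.mem_insert.1 hx with rfl | hx
      · exact hadj hb'x.symm
      · exact Finset.ne_of_mem_erase hx (hpriv b' a h' x (Finset.mem_of_mem_erase hx) hb'x)
  · intro b hb a ha h huniq
    by_contra! hcon
    have hbe : b ∉ A.erase a := fun h => hb (Finset.mem_of_mem_erase h)
    have hab := hpriv' b a h
    have hbN : ∀ c, G.Adj b c → c = a := fun c hc => by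
      by_cases hcA : c ∈ A
      · exact hpriv b a h c hcA hc
      · exact absurd hc (hcon c hcA)
    have hdb : G.degree b = 1 := by
      rw [← G.card_neighborFinset_eq_degree, Finset.card_eq_one]
      refine ⟨a, Finset.ext fun c => ?_⟩
      rw [mem_neighborFinset, Finset.mem_singleton]
      exact ⟨hbN c, fun hc => hc ▸ hab⟩
    -- Exchanging `a` for the pendant vertex `b` cannot lower the degree sum, so `a` is pendant too
    -- and the edge `ab` would be isolated.
    have hda : G.degree a ≤ 1 := by
      have h1 := hmin (insert b (A.erase a)) (Finset.mem_filter.2 ⟨hswap b a h, by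
        rw [Finset.card_insert_of_notMem hbe, Finset.card_erase_of_mem ha, ← hA.2]
        have := Finset.card_pos.2 ⟨a, ha⟩
        omega⟩)
      rw [Finset.sum_insert hbe, ← Finset.add_sum_erase A _ ha, hdb] at h1
      omega
    have haN : ∀ c, G.Adj a c → c = b := fun c hc => by
      rw [← G.card_neighborFinset_eq_degree] at hda
      exact Finset.card_le_one.1 hda c ((G.mem_neighborFinset a c).2 hc) b
        ((G.mem_neighborFinset a b).2 hab.symm)
    refine hG s(a, b) ⟨hab.symm, fun f hf v hv hvf => ?_⟩
    obtain ⟨w, rfl⟩ := hvf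
    rcases Sym2.mem_iff.1 hv with rfl | rfl
    · rw [haN w hf]
    · rw [hbN w hf, Sym2.eq_swap]

/-- For the edges `(u, w)` leaving `u` upwards outside `A`, the next such edge at `u`, or a fixed
edge from `u` into `A` for the last of them. -/
theorem exists_next_neighbor {V : Type*} [Fintype V] [DecidableEq V] (G : SimpleGraph V)
    (A : Finset V) (rk : V → ℕ) (hrk : Function.Injective rk) (sp : V → V)
    (hsp : ∀ b ∉ A, sp b ∈ A ∧ G.Adj b (sp b)) (B : Finset (V × V))
    (hB : ∀ x, x ∈ B ↔ x.1 ∉ A ∧ x.2 ∉ A ∧ G.Adj x.1 x.2 ∧ rk x.1 < rk x.2) :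
    ∃ nxt : V × V → V, (∀ x ∈ B, G.Adj x.1 (nxt x)) ∧
      (∀ x ∈ B, nxt x = sp x.1 ∨ nxt x ∉ A ∧ rk x.2 < rk (nxt x)) ∧
      ∀ x ∈ B, ∀ y ∈ B, x.1 = y.1 → nxt x = nxt y → x = y := by
  classical
  have hex : ∀ x : V × V, ∃ n, x ∈ B → G.Adj x.1 n ∧ (n = sp x.1 ∨ n ∉ A ∧ rk x.2 < rk n) ∧
      ∀ v ∉ A, G.Adj x.1 v → rk x.2 < rk v → n ∉ A ∧ rk n ≤ rk v := by
    intro x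
    rcases (Finset.univ.filter fun v => v ∉ A ∧ G.Adj x.1 v ∧ rk x.2 < rk v).eq_empty_or_nonempty
      with h | h
    · refine ⟨sp x.1, fun hx => ⟨(hsp _ ((hB x).1 hx).1).2, Or.inl rfl, fun v h1 h2 h3 => ?_⟩⟩
      have : v ∈ Finset.univ.filter fun v => v ∉ A ∧ G.Adj x.1 v ∧ rk x.2 < rk v := by
        simp [h1, h2, h3]
      rw [h] at this
      simp at this
    · obtain ⟨n, hn, hmin⟩ := Finset.exists_min_image _ rk h
      simp only [Finset.mem_filter, Finset.mem_univ, true_and] at hn hmin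
      exact ⟨n, fun _ => ⟨hn.2.1, Or.inr ⟨hn.1, hn.2.2⟩, fun v h1 h2 h3 =>
        ⟨hn.1, hmin v ⟨h1, h2, h3⟩⟩⟩⟩
  choose nxt hnxt using hex
  refine ⟨nxt, fun x hx => (hnxt x hx).1, fun x hx => (hnxt x hx).2.1, ?_⟩
  -- If `y.2` is above `x.2`, it is a candidate for `nxt x`, whose rank is then at most that of
  -- `y.2`; but `nxt y` lies in `A` or strictly above `y.2`.
  have key : ∀ x ∈ B, ∀ y ∈ B, x.1 = y.1 → nxt x = nxt y → ¬ rk x.2 < rk y.2 := by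
    intro x hx y hy h1 h2 hlt
    have hy' := (hB y).1 hy
    obtain ⟨h3, h4⟩ := (hnxt x hx).2.2 y.2 hy'.2.1 (h1 ▸ hy'.2.2.1) hlt
    rcases (hnxt y hy).2.1 with h5 | h5
    · rw [h2, h5] at h3
      exact h3 (hsp _ hy'.1).1
    · rw [h2] at h4
      omega
  intro x hx y hy h1 h2
  refine Prod.ext h1 (hrk ?_)
  have := key x hx y hy h1 h2
  have := key y hy x hx h1.symm h2.symm
  omega

/-! ### The construction and the count of edge uses. -/

theorem IsNice.totalWeightPairChoosable_one_five {V : Type*} [Fintype V] [DecidableEq V]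
    {G : SimpleGraph V} [DecidableRel G.Adj] (hG : G.IsNice) :
    G.TotalWeightPairChoosable 1 5 := by
  classical
  obtain ⟨A, hA, hdom, hclique, hpriv⟩ := hG.exists_independent
  let N : V → Finset V := fun b => A.filter (G.Adj b)
  have hN : ∀ b a, a ∈ N b ↔ a ∈ A ∧ G.Adj b a := fun b a => Finset.mem_filter
  have hex : ∀ b, ∃ a, b ∉ A → a ∈ N b := fun b => by
    by_cases hb : b ∈ A
    · exact ⟨b, fun h => absurd hb h⟩
    · obtain ⟨a, ha, hba⟩ := hdom b hb
      exact ⟨a, fun _ => (hN b a).2 ⟨ha, hba⟩⟩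
  choose α₁ hα₁ using hex
  -- These vertices have neither a second neighbour in `A` nor a second private neighbour of `α₁ b`
  -- to form a triangle with.
  let D : Finset V := Finset.univ.filter fun b =>
    b ∉ A ∧ N b = {α₁ b} ∧ ∀ b' ∉ A, N b' = {α₁ b} → b' = b
  have hD : ∀ b, b ∈ D ↔ b ∉ A ∧ N b = {α₁ b} ∧ ∀ b' ∉ A, N b' = {α₁ b} → b' = b :=
    fun b => by simp [D]
  let Γ : SimpleGraph V :=
    { Adj := fun u v => G.Adj u v ∧ u ∉ A ∧ v ∉ A
      symm := ⟨fun u v h => ⟨h.1.symm, h.2.2, h.2.1⟩⟩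
      loopless := ⟨fun u h => h.1.ne rfl⟩ }
  obtain ⟨R, D', par, M, hRD, hRind, hD'D, hD'R, hpar, hparinj, hM, hDM, hMR, hM2⟩ :=
    exists_pairing Γ D fun b hb => by
      obtain ⟨h1, h2, h3⟩ := (hD b).1 hb
      obtain ⟨c, hc, hbc⟩ := hpriv b h1 (α₁ b) ((hN _ _).1 (hα₁ b h1)).1 h2 h3
      exact ⟨c, hbc, h1, hc⟩
  have hM2A : ∀ m ∈ M, m.2 ∉ A := by
    intro m hm
    obtain ⟨h1, -, h2 | h2⟩ := hM m hm
    · rw [h2]; exact (hpar _ h1).2.2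
    · exact (hpar _ h2.1).2.1
  -- The edge to `a` (later `α b`) carries the pairs, the edge to `a'` (later `sp b`) the end of the
  -- `nxt` chain. They are distinct when possible, and `a` must avoid the `A`-end of the partner of
  -- `b`, so that a pair has two distinct ends.
  have hex : ∀ b, ∃ a a', b ∉ A → a ∈ N b ∧ a' ∈ N b ∧
      (N b = {α₁ b} → a = α₁ b ∧ a' = α₁ b) ∧
      (N b ≠ {α₁ b} → a ≠ a' ∧ ∀ m ∈ M, m.2 = b → α₁ m.1 ≠ a) := by
    intro b
    by_cases hb : b ∈ A
    · exact ⟨b, b, fun h => absurd hb h⟩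
    by_cases h1 : N b = {α₁ b}
    · exact ⟨α₁ b, α₁ b, fun _ => ⟨hα₁ b hb, hα₁ b hb, fun _ => ⟨rfl, rfl⟩, fun h => absurd h1 h⟩⟩
    obtain ⟨y, hy, hyα⟩ : ∃ y ∈ N b, y ≠ α₁ b := by
      by_contra! hcon
      exact h1 (Finset.eq_singleton_iff_unique_mem.2 ⟨hα₁ b hb, hcon⟩)
    have hbR : b ∉ R := fun h => h1 ((hD b).1 (hRD h)).2.1
    by_cases h2 : ∃ m ∈ M, m.2 = b ∧ α₁ m.1 = α₁ b
    · obtain ⟨m, hm, hmb, hmα⟩ := h2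
      refine ⟨y, α₁ b, fun _ => ⟨hy, hα₁ b hb, fun h => absurd h h1, fun _ => ⟨hyα, ?_⟩⟩⟩
      intro m' hm' hm'b
      rw [hMR b hbR m' hm' m hm (Or.inr hm'b) (Or.inr hmb), hmα]
      exact hyα.symm
    · push Not at h2
      exact ⟨α₁ b, y, fun _ => ⟨hα₁ b hb, hy, fun h => absurd h h1, fun _ => ⟨hyα.symm, h2⟩⟩⟩
  choose α sp hαsp using hex
  have hα : ∀ b ∉ A, α b ∈ A ∧ G.Adj b (α b) := fun b hb => (hN _ _).1 (hαsp b hb).1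
  have hsp : ∀ b ∉ A, sp b ∈ A ∧ G.Adj b (sp b) := fun b hb => (hN _ _).1 (hαsp b hb).2.1
  have hα1 : ∀ b ∉ A, N b = {α₁ b} → α b = α₁ b := fun b hb h => ((hαsp b hb).2.2.1 h).1
  have hαD : ∀ b ∈ D, ∀ b' ∉ A, N b' = {α₁ b'} → α b' = α b → b' = b := by
    intro b hb b' hb' h1 h2
    obtain ⟨h3, h4, h5⟩ := (hD b).1 hb
    rw [hα1 b h3 h4, hα1 b' hb' h1] at h2
    exact h5 b' hb' (h2 ▸ h1)
  have hαM : ∀ m ∈ M, α m.1 ≠ α m.2 := by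
    intro m hm h
    have h1 := hD'D (hM m hm).1
    by_cases h2 : N m.2 = {α₁ m.2}
    · exact (hM m hm).2.1 (hαD m.1 h1 m.2 (hM2A m hm) h2 h.symm).symm
    · refine ((hαsp _ (hM2A m hm)).2.2.2 h2).2 m hm rfl ?_
      rw [← h, hα1 _ ((hD _).1 h1).1 ((hD _).1 h1).2.1]
  have hex : ∀ c, ∃ π : Equiv.Perm V, c ∉ A → N c ≠ {α₁ c} →
      (∀ a ∈ N c, π a ∈ N c) ∧ (∀ a ∈ N c, π a ≠ a) ∧ π (α c) = sp c := by
    intro c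
    by_cases h : c ∉ A ∧ N c ≠ {α₁ c}
    · obtain ⟨h1, h2, -, h3⟩ := hαsp c h.1
      obtain ⟨π, hπ⟩ := (N c).exists_perm_derangement h1 h2 (h3 h.2).1
      exact ⟨π, fun _ _ => hπ⟩
    · exact ⟨1, fun h1 h2 => absurd ⟨h1, h2⟩ h⟩
  choose π hπ using hex
  have hex : ∀ a, ∃ τ : Equiv.Perm V,
      (∃ b ∉ A, N b = {a} ∧ ∃ b' ∉ A, N b' = {a} ∧ b' ≠ b) →
        ∀ b ∉ A, N b = {a} → τ b ∉ A ∧ N (τ b) = {a} ∧ τ b ≠ b := by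
    intro a
    by_cases h : ∃ b ∉ A, N b = {a} ∧ ∃ b' ∉ A, N b' = {a} ∧ b' ≠ b
    · obtain ⟨b, hb, hba, b', hb', hba', hne⟩ := h
      obtain ⟨τ, h1, h2, -⟩ := (Finset.univ.filter fun b => b ∉ A ∧ N b = {a}).exists_perm_derangement
        (z := b) (z' := b') (by simp [hb, hba]) (by simp [hb', hba']) hne.symm
      simp only [Finset.mem_filter, Finset.mem_univ, true_and] at h1 h2
      exact ⟨τ, fun _ x hx hxa => ⟨(h1 x ⟨hx, hxa⟩).1, (h1 x ⟨hx, hxa⟩).2, h2 x ⟨hx, hxa⟩⟩⟩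
    · exact ⟨1, fun h' => absurd h' h⟩
  choose τ hτ using hex
  have hτ' : ∀ c ∉ A, N c = {α₁ c} → c ∉ D → τ (α₁ c) c ∉ A ∧ N (τ (α₁ c) c) = {α₁ c} ∧
      τ (α₁ c) c ≠ c := by
    intro c hc h1 h2
    refine hτ (α₁ c) ⟨c, hc, h1, ?_⟩ c hc h1
    by_contra! hcon
    exact h2 ((hD c).2 ⟨hc, h1, hcon⟩)
  -- Vertices of `R` come last. As `R` is independent in `Γ`, no pair of `B` starts there, which
  -- frees the edge from such a vertex into `A` for two doubled path vectors.
  let rk : V → ℕ := fun v => (Fintype.equivFin V v).1 + if v ∈ R then Fintype.card V else 0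
  have hrk : Function.Injective rk := by
    intro u v h
    have h1 := (Fintype.equivFin V u).2
    have h2 := (Fintype.equivFin V v).2
    apply (Fintype.equivFin V).injective
    apply Fin.ext
    simp only [rk] at h
    split_ifs at h <;> omega
  let B : Finset (V × V) := Finset.univ.filter fun x =>
    x.1 ∉ A ∧ x.2 ∉ A ∧ G.Adj x.1 x.2 ∧ rk x.1 < rk x.2
  have hB : ∀ x, x ∈ B ↔ x.1 ∉ A ∧ x.2 ∉ A ∧ G.Adj x.1 x.2 ∧ rk x.1 < rk x.2 :=
    fun x => by simp [B]
  have hBR : ∀ x ∈ B, x.1 ∉ R := by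
    intro x hx hxR
    obtain ⟨h1, h2, h3, h4⟩ := (hB x).1 hx
    have h5 : x.2 ∉ R := fun h => hRind _ hxR _ h ⟨h3, h1, h2⟩
    have h6 := (Fintype.equivFin V x.2).2
    simp only [rk, if_pos hxR, if_neg h5] at h4
    omega
  obtain ⟨nxt, hnxt1, hnxt2, hnxt3⟩ := G.exists_next_neighbor A rk hrk sp hsp B hB
  let δ : V → V → Sym2 V → ℝ := fun u v => Pi.single s(u, v) 1
  have hδ : ∀ u v e, e ≠ s(u, v) → δ u v e = 0 := fun u v e h => Pi.single_eq_of_ne h _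
  have hδb : ∀ u v, G.Adj u v → ∀ w, G.boundary (δ u v) w =
      (if w = u then 1 else 0) + if w = v then 1 else 0 := fun u v h w => boundary_single h w
  let zB : V × V → Sym2 V → ℝ := fun x => δ x.1 x.2 - δ x.1 (nxt x)
  -- Omitting `(b, α b)` loses no end, since `α b` is the second end of another difference. It saves
  -- one use of the edge to `α b`, for a pair, and one of the edge to `sp b = π b (α b)`, for `B`.
  let T : Finset (V × V) := Finset.univ.filter fun x =>
    x.1 ∉ A ∧ N x.1 ≠ {α₁ x.1} ∧ x.2 ∈ N x.1 ∧ x.2 ≠ α x.1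
  have hT : ∀ x, x ∈ T ↔ x.1 ∉ A ∧ N x.1 ≠ {α₁ x.1} ∧ x.2 ∈ N x.1 ∧ x.2 ≠ α x.1 :=
    fun x => by simp [T]
  let zT : V × V → Sym2 V → ℝ := fun x => δ x.1 x.2 - δ x.1 (π x.1 x.2)
  -- Alternating signs along the path cancel its inner vertices; the parity of its length decides
  -- between sum and difference of the ends.
  let zM : V × V → Sym2 V → ℝ := fun m =>
    if m.2 = par m.1 then δ m.1 (α m.1) - δ m.1 m.2 + δ m.2 (α m.2)
    else δ m.1 (α m.1) - δ m.1 (par m.1) + δ m.2 (par m.2) - δ m.2 (α m.2)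
  let U : Finset V := Finset.univ.filter fun c =>
    c ∉ A ∧ N c = {α₁ c} ∧ ∀ m ∈ M, ¬ (m.1 = c ∨ m.2 = c)
  have hU : ∀ c, c ∈ U ↔ c ∉ A ∧ N c = {α₁ c} ∧ ∀ m ∈ M, ¬ (m.1 = c ∨ m.2 = c) :=
    fun c => by simp [U]
  have hUD : ∀ c ∈ U, c ∉ D := fun c hc hcD => by
    obtain ⟨m, hm, h⟩ := hDM c hcD
    exact ((hU c).1 hc).2.2 m hm h
  have hUτ : ∀ c ∈ U, τ (α₁ c) c ∉ A ∧ N (τ (α₁ c) c) = {α₁ c} ∧ τ (α₁ c) c ≠ c := fun c hc =>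
    hτ' c ((hU c).1 hc).1 ((hU c).1 hc).2.1 (hUD c hc)
  -- On a triangle, half the alternating sum has boundary the single vertex `α₁ c`; the third edge
  -- exists by the clique property.
  let zU : V → Sym2 V → ℝ := fun c => (1 / 2 : ℝ) •
    (δ c (α₁ c) + δ (τ (α₁ c) c) (α₁ c) - δ c (τ (α₁ c) c))
  have hNadj : ∀ b a, N b = {a} → G.Adj b a := fun b a h =>
    ((hN b a).1 (h ▸ Finset.mem_singleton_self a)).2
  refine G.totalWeightPairChoosable_of_forms (M := T ⊕ M) (P := U) A rk hA hrk B hB zB ?_ ?_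
    (Sum.elim (fun x => x.1.2) fun m => α m.1.1)
    (Sum.elim (fun x => π x.1.1 x.1.2) fun m => α m.1.2) ?_ ?_ ?_
    (Sum.elim (fun _ => -1) fun m => if m.1.2 = par m.1.1 then 1 else -1) ?_
    (Sum.elim (fun x => zT x.1) fun m => zM m.1) ?_ (fun c => α₁ c.1) ?_ (fun c => zU c.1) ?_
    (Sum.elim (fun x => x.1.1) fun m => m.1.1) (Sum.elim (fun x => x.1.1) fun m => m.1.2)
    (fun c => c.1) ?_ ?_
  · intro x hx
    obtain ⟨h1, h2, h3, h4⟩ := (hB x).1 hx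
    have h5 : x.2 ≠ nxt x := by
      rcases hnxt2 x hx with h | h
      · exact fun h' => h2 (h' ▸ h ▸ (hsp _ h1).1)
      · exact fun h' => by rw [← h'] at h; omega
    simp only [zB, boundary_sub]
    rw [hδb _ _ h3, hδb _ _ (hnxt1 x hx)]
    simp [h5]
  · intro x hx v hv hlt
    obtain ⟨h1, h2, h3, h4⟩ := (hB x).1 hx
    have h5 : v ≠ nxt x := by
      rcases hnxt2 x hx with h | h
      · exact fun h' => hv (h' ▸ h ▸ (hsp _ h1).1)
      · exact fun h' => by rw [← h'] at h; omega
    have h6 : v ≠ x.2 := fun h => by rw [h] at hlt; omega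
    simp only [zB, boundary_sub]
    rw [hδb _ _ h3, hδb _ _ (hnxt1 x hx)]
    simp [h5, h6]
  · rintro (⟨x, hx⟩ | ⟨m, hm⟩)
    · exact ((hN _ _).1 ((hT x).1 hx).2.2.1).1
    · exact (hα _ ((hD _).1 (hD'D (hM m hm).1)).1).1
  · rintro (⟨x, hx⟩ | ⟨m, hm⟩)
    · obtain ⟨h1, h2, h3, -⟩ := (hT x).1 hx
      exact ((hN _ _).1 ((hπ _ h1 h2).1 _ h3)).1
    · exact (hα _ (hM2A m hm)).1
  · rintro (⟨x, hx⟩ | ⟨m, hm⟩)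
    · obtain ⟨h1, h2, h3, -⟩ := (hT x).1 hx
      exact ((hπ _ h1 h2).2.1 _ h3).symm
    · exact hαM m hm
  · rintro (⟨x, hx⟩ | ⟨m, hm⟩)
    · exact Or.inr rfl
    · simp only [Sum.elim_inr]
      split_ifs
      · exact Or.inl rfl
      · exact Or.inr rfl
  · rintro (⟨x, hx⟩ | ⟨m, hm⟩) v
    · obtain ⟨h1, h2, h3, -⟩ := (hT x).1 hx
      change G.boundary (zT x) v = (if v = x.2 then 1 else 0) +
        (-1) * if v = π x.1 x.2 then 1 else 0
      simp only [zT, boundary_sub]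
      rw [hδb _ _ ((hN _ _).1 h3).2, hδb _ _ ((hN _ _).1 ((hπ _ h1 h2).1 _ h3)).2]
      ring
    · obtain ⟨h1, h2, h3⟩ := hM m hm
      have h4 := hpar _ h1
      change G.boundary (zM m) v = (if v = α m.1 then 1 else 0) +
        (if m.2 = par m.1 then 1 else -1) * if v = α m.2 then 1 else 0
      by_cases h5 : m.2 = par m.1
      · have h6 : G.Adj m.1 m.2 := h5 ▸ h4.1
        simp only [zM, if_pos h5]
        rw [boundary_add, boundary_sub, hδb _ _ (hα _ h4.2.1).2,
          hδb _ _ (hα _ (hM2A m hm)).2, hδb _ _ h6]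
        ring
      · have h6 := h3.resolve_left h5
        simp only [zM, if_neg h5]
        rw [boundary_sub, boundary_add, boundary_sub, hδb _ _ (hα _ h4.2.1).2,
          hδb _ _ (hα _ (hM2A m hm)).2, hδb _ _ h4.1, hδb _ _ (hpar _ h6.1).1, h6.2]
        ring
  · exact fun c => ((hN _ _).1 (hα₁ _ ((hU _).1 c.2).1)).1
  · rintro ⟨c, hc⟩ v
    obtain ⟨h1, h2, h3⟩ := hUτ c hc
    have h4 := ((hU c).1 hc)
    have h5 : G.Adj c (τ (α₁ c) c) :=
      hclique c h4.1 _ h1 (α₁ c) ((hN _ _).1 (hα₁ _ h4.1)).1 h3.symm h4.2.1 h2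
    simp only [zU, boundary_smul, boundary_sub, boundary_add]
    rw [hδb _ _ (hNadj _ _ h4.2.1), hδb _ _ (hNadj _ _ h2), hδb _ _ h5]
    ring
  · intro b hb a ha hba
    by_cases h1 : N b = {α₁ b}
    · have haα : a = α₁ b := Finset.mem_singleton.1 (h1 ▸ (hN b a).2 ⟨ha, hba⟩)
      by_cases h2 : b ∈ U
      · exact Or.inr (Or.inr ⟨⟨b, h2⟩, haα.symm, rfl⟩)
      · obtain ⟨m, hm, h3⟩ : ∃ m ∈ M, m.1 = b ∨ m.2 = b := by
          by_contra hcon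
          exact h2 ((hU b).2 ⟨hb, h1, fun m hm h => hcon ⟨m, hm, h⟩⟩)
        rw [← hα1 b hb h1] at haα
        rcases h3 with h3 | h3
        · exact Or.inl ⟨Sum.inr ⟨m, hm⟩, by simp [h3, haα], h3⟩
        · exact Or.inr (Or.inl ⟨Sum.inr ⟨m, hm⟩, by simp [h3, haα], h3⟩)
    · by_cases h2 : a = α b
      · refine Or.inr (Or.inl ⟨Sum.inl ⟨(b, (π b)⁻¹ a), (hT _).2 ⟨hb, h1, ?_, ?_⟩⟩, by simp, rfl⟩)
        · have hmaps := (hπ b hb h1).1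
          have himg : (N b).image (π b) = N b :=
            Finset.eq_of_subset_of_card_le (Finset.image_subset_iff.2 hmaps)
              (Finset.card_image_of_injective _ (π b).injective).ge
          obtain ⟨x, hx, hxa⟩ := Finset.mem_image.1 (himg.symm ▸ (hN b a).2 ⟨ha, hba⟩)
          have : (π b)⁻¹ a = x := by rw [← hxa]; simp
          simpa only [this] using hx
        · intro h
          apply (hπ b hb h1).2.1 (α b) (hαsp b hb).1
          have h3 : π b ((π b)⁻¹ a) = a := by simp
          have h : (π b)⁻¹ a = α b := h
          rwa [h, h2] at h3
      · exact Or.inl ⟨Sum.inl ⟨(b, a), (hT _).2 ⟨hb, h1, (hN b a).2 ⟨ha, hba⟩, h2⟩⟩, rfl, rfl⟩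
  · let FB : Sym2 V → Finset (V × V) := fun e => B.filter fun x => zB x e ≠ 0
    let FT : Sym2 V → Finset (V × V) := fun e => T.filter fun x => zT x e ≠ 0
    let FM : Sym2 V → Finset (V × V) := fun e => M.filter fun m => zM m e ≠ 0
    let FU : Sym2 V → Finset V := fun e => U.filter fun c => zU c e ≠ 0
    have hcr : ∀ b a x y, b ∉ A → a ∈ A → x ∉ A → y ∈ A → s(b, a) = s(x, y) → x = b ∧ y = a := by
      intro b a x y hb ha hx hy h
      rcases Sym2.eq_iff.1 h with h | h
      · exact ⟨h.1.symm, h.2.symm⟩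
      · exact absurd (h.1 ▸ hy) hb
    have hin : ∀ b a x y, a ∈ A → x ∉ A → y ∉ A → s(b, a) ≠ s(x, y) := by
      intro b a x y ha hx hy h
      rcases Sym2.eq_iff.1 h with h | h
      · exact hy (h.2 ▸ ha)
      · exact hx (h.2 ▸ ha)
    have hFB : ∀ e, ∀ x ∈ FB e, x ∈ B ∧ (e = s(x.1, x.2) ∨ e = s(x.1, nxt x)) := by
      intro e x hx
      obtain ⟨hx, h0⟩ := Finset.mem_filter.1 hx
      refine ⟨hx, ?_⟩
      by_contra! hcon
      exact h0 (by simp [zB, hδ _ _ _ hcon.1, hδ _ _ _ hcon.2])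
    have hFT : ∀ e, ∀ x ∈ FT e, x ∈ T ∧ (e = s(x.1, x.2) ∨ e = s(x.1, π x.1 x.2)) := by
      intro e x hx
      obtain ⟨hx, h0⟩ := Finset.mem_filter.1 hx
      refine ⟨hx, ?_⟩
      by_contra! hcon
      exact h0 (by simp [zT, hδ _ _ _ hcon.1, hδ _ _ _ hcon.2])
    have hFM : ∀ e, ∀ m ∈ FM e, m ∈ M ∧ (e = s(m.1, α m.1) ∨ e = s(m.2, α m.2) ∨
        ∃ x, (m.1 = x ∨ m.2 = x) ∧ x ∈ D' ∧ e = s(x, par x)) := by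
      intro e m hm
      obtain ⟨hm, h0⟩ := Finset.mem_filter.1 hm
      refine ⟨hm, ?_⟩
      by_contra! hcon
      obtain ⟨h1, h2, h3⟩ := hcon
      obtain ⟨h4, -, h5⟩ := hM m hm
      have h6 := h3 m.1 (Or.inl rfl) h4
      by_cases h7 : m.2 = par m.1
      · rw [← h7] at h6
        exact h0 (by simp only [zM, if_pos h7]; simp [hδ _ _ _ h1, hδ _ _ _ h2, hδ _ _ _ h6])
      · have h8 := h3 m.2 (Or.inr rfl) (h5.resolve_left h7).1
        exact h0 (by
          simp only [zM, if_neg h7]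
          simp [hδ _ _ _ h1, hδ _ _ _ h2, hδ _ _ _ h6, hδ _ _ _ h8])
    have hFU : ∀ e, ∀ c ∈ FU e, c ∈ U ∧ (e = s(c, α₁ c) ∨ e = s(τ (α₁ c) c, α₁ c) ∨
        e = s(c, τ (α₁ c) c)) := by
      intro e c hc
      obtain ⟨hc, h0⟩ := Finset.mem_filter.1 hc
      refine ⟨hc, ?_⟩
      by_contra! hcon
      exact h0 (by simp [zU, hδ _ _ _ hcon.1, hδ _ _ _ hcon.2.1, hδ _ _ _ hcon.2.2])
    have hUα : ∀ c ∈ U, α₁ c ∈ A := fun c hc =>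
      ((hN _ _).1 (hα₁ c ((hU c).1 hc).1)).1
    have hUD' : ∀ c ∈ U, τ (α₁ c) c ∉ D := by
      intro c hc h
      obtain ⟨h1, h2, h3⟩ := hUτ c hc
      obtain ⟨h4, h5, h6⟩ := (hD _).1 h
      refine h3 (h6 c ((hU c).1 hc).1 ?_).symm
      rw [((hU c).1 hc).2.1, ← h2, h5]
    -- At most two uses come from `B`, as a current and as a next edge. Two more come either from
    -- one doubled path or from triangles based at its two ends, never both, since path edges start
    -- in `D` and triangles avoid `D`.
    have hinner : ∀ u v, u ∉ A → v ∉ A →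
        (FB s(u, v)).card + 2 * ((FT s(u, v)).card + (FM s(u, v)).card) + (FU s(u, v)).card ≤ 4 := by
      intro u v hu hv
      have hT0 : (FT s(u, v)).card = 0 := by
        rw [Finset.card_eq_zero, Finset.eq_empty_iff_forall_notMem]
        intro x hx
        obtain ⟨h1, h2⟩ := hFT _ x hx
        obtain ⟨h3, h4, h5, -⟩ := (hT x).1 h1
        rcases h2 with h2 | h2
        · exact hin _ _ _ _ ((hN _ _).1 h5).1 hu hv h2.symm
        · exact hin _ _ _ _ ((hN _ _).1 ((hπ _ h3 h4).1 _ h5)).1 hu hv h2.symm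
      have hM1 : ∀ m ∈ FM s(u, v), m ∈ M ∧
          ∃ x, (m.1 = x ∨ m.2 = x) ∧ x ∈ D' ∧ s(u, v) = s(x, par x) := by
        intro m hm
        obtain ⟨h1, h2⟩ := hFM _ m hm
        refine ⟨h1, ?_⟩
        rcases h2 with h2 | h2 | h2
        · exact absurd h2.symm (hin _ _ _ _ (hα _ ((hD _).1 (hD'D (hM m h1).1)).1).1 hu hv)
        · exact absurd h2.symm (hin _ _ _ _ (hα _ (hM2A m h1)).1 hu hv)
        · exact h2
      have hM1' : (FM s(u, v)).card ≤ 1 := by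
        refine Finset.card_le_one.2 fun m hm m' hm' => ?_
        obtain ⟨h1, x, h2, h3, h4⟩ := hM1 m hm
        obtain ⟨h1', x', h2', h3', h4'⟩ := hM1 m' hm'
        obtain rfl := hparinj x h3 x' h3' (h4 ▸ h4')
        exact hMR x (Finset.disjoint_left.1 hD'R h3) m h1 m' h1' h2 h2'
      have hU1 : ∀ c ∈ FU s(u, v), c ∈ U ∧ s(u, v) = s(c, τ (α₁ c) c) := by
        intro c hc
        obtain ⟨h1, h2⟩ := hFU _ c hc
        refine ⟨h1, ?_⟩
        rcases h2 with h2 | h2 | h2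
        · exact absurd h2.symm (hin _ _ _ _ (hUα c h1) hu hv)
        · exact absurd h2.symm (hin _ _ _ _ (hUα c h1) hu hv)
        · exact h2
      have hU2 : (FU s(u, v)).card ≤ 2 := by
        refine (Finset.card_le_card fun c hc => ?_).trans (Finset.card_le_two (a := u) (b := v))
        have : c ∈ s(u, v) := (hU1 c hc).2 ▸ Sym2.mem_mk_left _ _
        simpa using this
      have hMU : (FM s(u, v)).card = 0 ∨ (FU s(u, v)).card = 0 := by
        by_contra! hcon
        obtain ⟨m, hm⟩ := Finset.card_ne_zero.1 hcon.1
        obtain ⟨c, hc⟩ := Finset.card_ne_zero.1 hcon.2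
        obtain ⟨-, x, -, h2, h3⟩ := hM1 m hm
        obtain ⟨h4, h5⟩ := hU1 c hc
        have h6 : x ∈ s(c, τ (α₁ c) c) := h5 ▸ h3 ▸ Sym2.mem_mk_left _ _
        rcases Sym2.mem_iff.1 h6 with h | h
        · exact hUD c h4 (h ▸ hD'D h2)
        · exact hUD' c h4 (h ▸ hD'D h2)
      have hB1 : ((FB s(u, v)).filter fun x => s(u, v) = s(x.1, x.2)).card ≤ 1 := by
        refine Finset.card_le_one.2 fun x hx y hy => ?_
        obtain ⟨hx, h1⟩ := Finset.mem_filter.1 hx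
        obtain ⟨hy, h2⟩ := Finset.mem_filter.1 hy
        have h3 := ((hB x).1 (hFB _ x hx).1).2.2.2
        have h4 := ((hB y).1 (hFB _ y hy).1).2.2.2
        rcases Sym2.eq_iff.1 (h1 ▸ h2) with h | h
        · exact Prod.ext h.1 h.2
        · rw [h.1, h.2] at h3
          omega
      have hB2 : ((FB s(u, v)).filter fun x => ¬ s(u, v) = s(x.1, x.2)).card ≤ 1 := by
        have hlt : ∀ x ∈ B, s(u, v) = s(x.1, nxt x) → rk x.1 < rk (nxt x) := by
          intro x hx h
          obtain ⟨h1, -, -, h2⟩ := (hB x).1 hx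
          rcases hnxt2 x hx with h3 | h3
          · exact absurd h.symm (hin _ _ _ _ (h3 ▸ (hsp _ h1).1) hu hv)
          · exact h2.trans h3.2
        refine Finset.card_le_one.2 fun x hx y hy => ?_
        obtain ⟨hx, h1⟩ := Finset.mem_filter.1 hx
        obtain ⟨hy, h2⟩ := Finset.mem_filter.1 hy
        obtain ⟨hx, h3⟩ := hFB _ x hx
        obtain ⟨hy, h4⟩ := hFB _ y hy
        replace h3 := h3.resolve_left h1
        replace h4 := h4.resolve_left h2
        have h5 := hlt x hx h3
        have h6 := hlt y hy h4
        rcases Sym2.eq_iff.1 (h3 ▸ h4) with h | h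
        · exact hnxt3 x hx y hy h.1 h.2
        · rw [h.1, h.2] at h5
          omega
      have hB3 := Finset.card_filter_add_card_filter_not (s := FB s(u, v))
        (fun x => s(u, v) = s(x.1, x.2))
      omega
    have houter : ∀ b a, b ∉ A → a ∈ A → G.Adj b a →
        (FB s(b, a)).card + 2 * ((FT s(b, a)).card + (FM s(b, a)).card) + (FU s(b, a)).card ≤ 4 := by
      intro b a hb ha hba
      have hBe : ∀ x ∈ FB s(b, a), x ∈ B ∧ x.1 = b ∧ nxt x = a ∧ a = sp b := by
        intro x hx
        obtain ⟨h1, h2⟩ := hFB _ x hx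
        obtain ⟨h3, h4, -⟩ := (hB x).1 h1
        replace h2 := h2.resolve_left (hin _ _ _ _ ha h3 h4)
        rcases hnxt2 x h1 with h5 | h5
        · obtain ⟨h6, h7⟩ := hcr _ _ _ _ hb ha h3 (h5 ▸ (hsp _ h3).1) h2
          exact ⟨h1, h6, h7, by rw [← h7, h5, h6]⟩
        · exact absurd h2 (hin _ _ _ _ ha h3 h5.1)
      have hB1 : (FB s(b, a)).card ≤ 1 := by
        refine Finset.card_le_one.2 fun x hx y hy => ?_
        obtain ⟨h1, h2, h3, -⟩ := hBe x hx
        obtain ⟨h1', h2', h3', -⟩ := hBe y hy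
        exact hnxt3 x h1 y h1' (h2.trans h2'.symm) (h3.trans h3'.symm)
      have hB0 : a ≠ sp b ∨ b ∈ R → (FB s(b, a)).card = 0 := by
        intro h
        rw [Finset.card_eq_zero, Finset.eq_empty_iff_forall_notMem]
        intro x hx
        obtain ⟨h1, h2, -, h3⟩ := hBe x hx
        exact h.elim (fun h => h h3) fun h => hBR x h1 (h2 ▸ h)
      have hMe : ∀ m ∈ FM s(b, a), m ∈ M ∧ (m.1 = b ∨ m.2 = b) ∧ a = α b := by
        intro m hm
        obtain ⟨h1, h2⟩ := hFM _ m hm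
        have h3 := ((hD _).1 (hD'D (hM m h1).1)).1
        rcases h2 with h2 | h2 | ⟨x, -, h4, h5⟩
        · obtain ⟨h6, h7⟩ := hcr _ _ _ _ hb ha h3 (hα _ h3).1 h2
          exact ⟨h1, Or.inl h6, by rw [← h7, h6]⟩
        · obtain ⟨h6, h7⟩ := hcr _ _ _ _ hb ha (hM2A m h1) (hα _ (hM2A m h1)).1 h2
          exact ⟨h1, Or.inr h6, by rw [← h7, h6]⟩
        · exact absurd h5 (hin _ _ _ _ ha ((hD _).1 (hD'D h4)).1 (hpar _ h4).2.2)
      have hMc2 : (FM s(b, a)).card ≤ 2 := by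
        refine (Finset.card_le_card fun m hm => ?_).trans (hM2 b)
        exact Finset.mem_filter.2 ⟨(hMe m hm).1, (hMe m hm).2.1⟩
      have hMc1 : b ∉ R → (FM s(b, a)).card ≤ 1 := fun h =>
        Finset.card_le_one.2 fun m hm m' hm' =>
          hMR b h m (hMe m hm).1 m' (hMe m' hm').1 (hMe m hm).2.1 (hMe m' hm').2.1
      have hMc0 : (a ≠ α b ∨ ∀ m ∈ M, ¬ (m.1 = b ∨ m.2 = b)) → (FM s(b, a)).card = 0 := by
        intro h
        rw [Finset.card_eq_zero, Finset.eq_empty_iff_forall_notMem]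
        intro m hm
        obtain ⟨h1, h2, h3⟩ := hMe m hm
        exact h.elim (fun h => h h3) fun h => h m h1 h2
      have hTe : ∀ x ∈ FT s(b, a), x ∈ T ∧ x.1 = b ∧ (x.2 = a ∨ π b x.2 = a) := by
        intro x hx
        obtain ⟨h1, h2⟩ := hFT _ x hx
        obtain ⟨h3, h4, h5, -⟩ := (hT x).1 h1
        rcases h2 with h2 | h2
        · obtain ⟨h6, h7⟩ := hcr _ _ _ _ hb ha h3 ((hN _ _).1 h5).1 h2
          exact ⟨h1, h6, Or.inl h7⟩
        · obtain ⟨h6, h7⟩ := hcr _ _ _ _ hb ha h3 ((hN _ _).1 ((hπ _ h3 h4).1 _ h5)).1 h2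
          exact ⟨h1, h6, Or.inr (h6 ▸ h7)⟩
      have hUe : ∀ c ∈ FU s(b, a), c ∈ U ∧ N b = {a} ∧ b ∉ D ∧ (c = b ∨ τ a c = b) := by
        intro c hc
        obtain ⟨h1, h2⟩ := hFU _ c hc
        have h3 := (hU c).1 h1
        obtain ⟨h4, h5, -⟩ := hUτ c h1
        rcases h2 with h2 | h2 | h2
        · obtain ⟨rfl, rfl⟩ := hcr _ _ _ _ hb ha h3.1 (hUα c h1) h2
          exact ⟨h1, h3.2.1, hUD c h1, Or.inl rfl⟩
        · obtain ⟨rfl, rfl⟩ := hcr _ _ _ _ hb ha h4 (hUα c h1) h2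
          exact ⟨h1, h5, hUD' c h1, Or.inr rfl⟩
        · exact absurd h2 (hin _ _ _ _ ha h3.1 h4)
      have hU0 : (N b ≠ {a} ∨ b ∈ D) → (FU s(b, a)).card = 0 := by
        intro h
        rw [Finset.card_eq_zero, Finset.eq_empty_iff_forall_notMem]
        intro c hc
        obtain ⟨-, h1, h2, -⟩ := hUe c hc
        exact h.elim (fun h => h h1) h2
      have hU2 : (FU s(b, a)).card ≤ 2 := by
        refine (Finset.card_le_card fun c hc => ?_).trans
          (Finset.card_le_two (a := b) (b := (τ a).symm b))
        rcases (hUe c hc).2.2.2 with h | h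
        · simp [h]
        · simp [← h]
      have hU1 : b ∉ U → (FU s(b, a)).card ≤ 1 := by
        intro hbU
        have hc : ∀ c ∈ FU s(b, a), τ a c = b := fun c hc =>
          (hUe c hc).2.2.2.resolve_left fun h => hbU (h ▸ (hUe c hc).1)
        exact Finset.card_le_one.2 fun c h c' h' =>
          (τ a).injective ((hc c h).trans (hc c' h').symm)
      -- The bound 4 is attained by two doubled paths at `b ∈ R`; by one path, one triangle and one
      -- `B` vector at a paired `b` outside `D`; and, when `b` has several neighbours in `A`, by a
      -- difference and a path at `α b` or two differences at an edge to neither `α b` nor `sp b`.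
      by_cases h1 : N b = {α₁ b}
      · have hT0 : (FT s(b, a)).card = 0 := by
          rw [Finset.card_eq_zero, Finset.eq_empty_iff_forall_notMem]
          intro x hx
          obtain ⟨h2, h3, -⟩ := hTe x hx
          exact ((hT x).1 h2).2.1 (h3 ▸ h1)
        by_cases h2 : b ∈ D
        · have := hU0 (Or.inr h2)
          by_cases h3 : b ∈ R
          · have := hB0 (Or.inr h3)
            omega
          · have := hMc1 h3
            omega
        · have h3 := hMc1 fun h => h2 (hRD h)
          by_cases h4 : b ∈ U
          · have := hMc0 (Or.inr ((hU b).1 h4).2.2)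
            omega
          · have := hU1 h4
            omega
      · have h2 : b ∉ R := fun h => h1 ((hD b).1 (hRD h)).2.1
        have h3 : N b ≠ {a} := fun h => h1 (by
          have := hα₁ b hb
          rw [h, Finset.mem_singleton] at this
          rw [h, this])
        have h4 := hU0 (Or.inl h3)
        have h5 := hMc1 h2
        have h6 : α b ≠ sp b := ((hαsp b hb).2.2.2 h1).1
        by_cases h7 : a = α b
        · have h8 := hB0 (Or.inl (h7 ▸ h6))
          have h9 : (FT s(b, a)).card ≤ 1 := by
            have hx : ∀ x ∈ FT s(b, a), x.1 = b ∧ π b x.2 = a := fun x hx => by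
              obtain ⟨h9, h10, h11⟩ := hTe x hx
              exact ⟨h10, h11.resolve_left fun h => ((hT x).1 h9).2.2.2 (by rw [h, h10, h7])⟩
            exact Finset.card_le_one.2 fun x h y h' =>
              Prod.ext ((hx x h).1.trans (hx y h').1.symm)
                ((π b).injective ((hx x h).2.trans (hx y h').2.symm))
          omega
        · have h8 := hMc0 (Or.inl h7)
          by_cases h9 : a = sp b
          · have h10 : (FT s(b, a)).card ≤ 1 := by
              have hx : ∀ x ∈ FT s(b, a), x.1 = b ∧ x.2 = a := fun x hx => by
                obtain ⟨h10, h11, h12⟩ := hTe x hx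
                refine ⟨h11, h12.resolve_right fun h => ((hT x).1 h10).2.2.2 ?_⟩
                rw [h11]
                apply (π b).injective
                rw [h, h9, (hπ b hb h1).2.2]
              exact Finset.card_le_one.2 fun x h y h' =>
                Prod.ext ((hx x h).1.trans (hx y h').1.symm) ((hx x h).2.trans (hx y h').2.symm)
            omega
          · have h10 := hB0 (Or.inl h9)
            have h11 : (FT s(b, a)).card ≤ 2 := by
              refine (Finset.card_le_card fun x hx => ?_).trans
                (Finset.card_le_two (a := (b, a)) (b := (b, (π b).symm a)))
              obtain ⟨-, h11, h12⟩ := hTe x hx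
              rcases h12 with h12 | h12
              · simp [Prod.ext_iff, h11, h12]
              · simp [Prod.ext_iff, h11, ← h12]
            omega
    intro e he
    have hcard : (B.filter fun x => zB x e ≠ 0).card +
        2 * ((FT e).card + (FM e).card) + (FU e).card ≤ 4 := by
      induction e using Sym2.ind with
      | _ u v =>
        have huv : G.Adj u v := he
        by_cases hu : u ∈ A
        · rw [Sym2.eq_swap]
          exact houter v u (fun hv => hA u hu v hv huv) hu huv.symm
        · by_cases hv : v ∈ A
          · exact houter u v hu hv huv
          · exact hinner u v hu hv
    refine le_of_eq_of_le ?_ hcard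
    simp only [FT, FM, FU, Finset.card_filter, Fintype.sum_sum_type, Sum.elim_inl, Sum.elim_inr]
    rw [← Finset.sum_coe_sort T, ← Finset.sum_coe_sort M, ← Finset.sum_coe_sort U]
    congr!

end SimpleGraph

theorem theorem1 {V : Type*} [Fintype V] [DecidableEq V] (G : SimpleGraph V)
    [DecidableRel G.Adj] (hG : G.IsNice) : G.TotalWeightPairChoosable 1 5 :=
  hG.totalWeightPairChoosable_one_five
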